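/- Let $F$ be a non-archimedean local field with residue characteristic $p$, let $G$ be a connected reductive group over $F$, $S$ a maximal split torus, $Z$ its centralizer, $N$ the normalizer of $Z$ in $G$, $Z^0$ the unique parahoric subgroup of $Z(F)$ and $Z(1)$ the pro-$p$ radical of $Z^0$. Put $W=N(F)/Z^0$, $W(1)=N(F)/Z(1)$, $Z_\kappa=Z^0/Z(1)$, $\Lambda=Z(F)/Z^0$, $\Lambda(1)=Z(F)/Z(1)$. Fix a set $\Delta$ of simple roots of the relative root system. For a standard parabolic subgroup $Q$, corresponding to $\Delta_Q\subset\Delta$, with standard Levi subgroup $M_Q$, let $W_Q\subset W$ and $W_Q(1)\subset W(1)$ be the images of $N(F)\cap M_Q(F)$, and let $W_{\mathrm{aff},Q}\subset W$ and $W_{\mathrm{aff},Q}(1)\subset W(1)$ be the images of $N(F)\cap M_Q'$, where $M_Q'\subset M_Q(F)$ is generated by the $F$-points of the unipotent radicals of the parabolic subgroups of $M_Q$. A *datum* $(W_{\mathrm{aff}},S_{\mathrm{aff}},\Omega,W,W(1),Z_\kappa)$ consists of a Coxeter system $(W_{\mathrm{aff}},S_{\mathrm{aff}})$, a group $\Omega$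 acting on it, $W=W_{\mathrm{aff}}\rtimes\Omega$, a finite commutative group $Z_\kappa$, and an extension $1\to Z_\kappa\to W(1)\to W\to1$. Let $C$ be a commutative ring. A *parameter* consists of maps $q\colon S_{\mathrm{aff}}\to C$ and $c\colon \mathrm{Ref}(1)\to C[Z_\kappa]$, where $\mathrm{Ref}(1)\subset W(1)$ is the inverse image of the set of reflections of $W_{\mathrm{aff}}$, such that $q_{wsw^{-1}}=q_s$ whenever $w\in W$ and $s,wsw^{-1}\in S_{\mathrm{aff}}$; $c_{wsw^{-1}}=w\cdot c_s$ for $w\in W(1)$ (with $w$ acting on $C[Z_\kappa]$ by conjugation); and $c_{ts}=tc_s$ for $t\in Z_\kappa$. The *attached algebra* is the $C$-algebra, free over $C$ with basis $(T_w)_{w\in W(1)}$, with $T_s^2=q_{\bar s}T_{s^2}+c_sT_s$ for each $s\in W(1)$ whose image $\bar s$ in $W$ lies in $S_{\mathrm{aff}}$, and $T_{vw}=T_vT_w$ whenever $\ell(vw)=\ell(v)+\ell(w)$. Here $\ell$ is the inflation to $W(1)$ of the length function of $W$ (length with respect to $S_{\mathrm{aff}}$, with $\Omega$ of length $0$). Let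 $P$ be a standard parabolic subgroup such that $\langle\Delta_P,\alpha^\vee\rangle=0$ for all $\alpha\in\Delta\setminus\Delta_P$, and let $P_2$ be the standard parabolic subgroup corresponding to $\Delta\setminus\Delta_P$. Let $(W_{\mathrm{aff},P},S_{\mathrm{aff},P},\Omega_P,W_P,W_P(1),Z_\kappa)$ be the datum attached to $M_P$: $S_{\mathrm{aff},P}$ is a set of simple reflections of $W_{\mathrm{aff},P}$, and $\Omega_P$ is the group of the elements of $W_P$ of length $0$, that is, of the elements normalizing $S_{\mathrm{aff},P}$. Let $(q,c)$ be a parameter for this datum, $\mathcal H_P$ the attached algebra with basis $(T^P_w)$, and $I$ the two-sided ideal of $\mathcal H_P$ generated by $T^P_\lambda-1$ for $\lambda\in\Lambda(1)\cap W_{\mathrm{aff},P_2}(1)$. Then $\Lambda\cap W_{\mathrm{aff},P_2}$, $\Lambda(1)\cap W_{\mathrm{aff},P_2}(1)$ and $Z_\kappa\cap W_{\mathrm{aff},P_2}(1)$ are normal subgroups of $W_P$, $W_P(1)$ and $Z_\kappa$ respectively, and $\Lambda\cap W_{\mathrm{aff},P_2}\subset\Omega_P$. Put $W'_{\mathrm{aff}}=W_{\mathrm{aff},P}$,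 $S'_{\mathrm{aff}}=S_{\mathrm{aff},P}$, $W'=W_P/(\Lambda\cap W_{\mathrm{aff},P_2})$, $\Omega'=\Omega_P/(\Lambda\cap W_{\mathrm{aff},P_2})$, $W'(1)=W_P(1)/(\Lambda(1)\cap W_{\mathrm{aff},P_2}(1))$ and $Z'_\kappa=Z_\kappa/(Z_\kappa\cap W_{\mathrm{aff},P_2}(1))$, with the induced maps between them. 1. $(W'_{\mathrm{aff}},S'_{\mathrm{aff}},\Omega',W',W'(1),Z'_\kappa)$ is a datum. 2. There is a map $c'$ such that $c'_{\bar s}$ is the image of $c_s$ in $C[Z'_\kappa]$ whenever $s\in W_P(1)$ lies over a reflection of $W_{\mathrm{aff},P}$ and has image $\bar s\in W'(1)$, and $(q,c')$ is a parameter for this datum. The algebra attached to the datum and to $(q,c')$ is $\mathcal H_P/I$, the basis element $T'_{\bar w}$ being the image of $T^P_w$ for $w\in W_P(1)$ with image $\bar w\in W'(1)$. 3. $\Omega'$ is commutative. -/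

import Mathlib

open scoped ValuativeRel Matrix MatrixGroups Topology

noncomputable section

/-! ## Data and parameters of a generic pro-`p` Hecke algebra -/

namespace ProP

variable {A O W W₁ Z : Type*} [Group A] [Group O] [Group W] [Group W₁] [Group Z]

/-- The conditions on `(W_aff, S_aff, Ω, W, W(1), Z_κ)`, where `A = W_aff`, `O = Ω`, `W₁ = W(1)`
and `Z = Z_κ`: `(A, S)` is a Coxeter system, `O` acts on it (by conjugation in `W`),
`W = A ⋊ O`, and `1 → Z → W₁ → W → 1` is an extension by a finite commutative group. -/
structure IsDatum (S : Set A) (i : A →* W) (j : O →* W) (ι : Z →* W₁) (π : W₁ →* W) : Prop where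
  coxeter : ∃ (M : CoxeterMatrix S) (cs : CoxeterSystem M A), ∀ s : S, cs.simple s = s
  injective_i : Function.Injective i
  injective_j : Function.Injective j
  acts : ∀ u : O, ∀ s ∈ S, ∃ s' ∈ S, j u * i s * (j u)⁻¹ = i s'
  semidirect : ∀ w : W, ∃! p : A × O, w = i p.1 * j p.2
  finite : Finite Z
  comm : ∀ a b : Z, a * b = b * a
  injective_ι : Function.Injective ι
  range_eq_ker : ι.range = π.ker
  surjective_π : Function.Surjective π

/-- The inverse image in `W(1)` of the set of reflections of `W_aff`. -/
def reflOne (S : Set A) (i : A →* W) (π : W₁ →* W) : Set W₁ :=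
  {w | ∃ a : A, ∃ s ∈ S, π w = i (a * s * a⁻¹)}

/-- The conditions on the parameter `(q, c)`. -/
structure IsParameter {C : Type*} [CommRing C] (S : Set A) (i : A →* W) (ι : Z →* W₁)
    (π : W₁ →* W) (q : S → C) (c : reflOne S i π → MonoidAlgebra C Z) : Prop where
  q_conj : ∀ (w : W) (s s' : S), w * i s * w⁻¹ = i s' → q s' = q s
  c_conj : ∀ (w : W₁) (s s' : reflOne S i π), (s' : W₁) = w * s * w⁻¹ →
    ∀ z z' : Z, ι z' = w * ι z * w⁻¹ → (c s').coeff z' = (c s).coeff z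
  c_mul : ∀ (z : Z) (s s' : reflOne S i π), (s' : W₁) = ι z * s →
    c s' = MonoidAlgebra.single z 1 * c s

/-- The length function of `W`: the length with respect to `S_aff`, where `Ω` has length `0`. -/
def length (S : Set A) (i : A →* W) (j : O →* W) (w : W) : ℕ :=
  sInf {l | ∃ L : List A, (∀ x ∈ L, x ∈ S) ∧ L.length = l ∧ ∃ u : O, w = i L.prod * j u}

/-- `H` is the algebra attached to the datum and the parameter, with standard basis `T`. -/
structure IsHeckeAlgebra {C : Type*} [CommRing C] (S : Set A) (i : A →* W) (j : O →* W)
    (ι : Z →* W₁) (π : W₁ →* W) (q : S → C) (c : reflOne S i π → MonoidAlgebra C Z)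
    {H : Type*} [Ring H] [Algebra C H] (T : Module.Basis W₁ C H) : Prop where
  quadratic : ∀ (s : S) (w : reflOne S i π), π w = i s →
    T w * T w = q s • T ((w : W₁) * w) + ((c w).coeff.sum fun z a => a • T (ι z)) * T w
  braid : ∀ v w : W₁,
    length S i j (π (v * w)) = length S i j (π v) + length S i j (π w) → T (v * w) = T v * T w

end ProP

/-! ## Linear algebraic groups, as Zariski closed subgroups of `GL n` over an algebraic closure -/

namespace AlgGrp

variable {K : Type*} [Field K] {n d : ℕ}

/-- The ideal of the polynomials in the matrix entries that vanish on `G`. -/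
def ideal (G : Subgroup (GL (Fin n) K)) : Ideal (MvPolynomial (Fin n × Fin n) K) where
  carrier := {f | ∀ g ∈ G, MvPolynomial.eval (fun p => (g : Matrix _ _ K) p.1 p.2) f = 0}
  add_mem' {a b} ha hb g hg := by simp [ha g hg, hb g hg]
  zero_mem' g _ := by simp
  smul_mem' c f hf g hg := by simp [hf g hg]

def IsClosed (G : Subgroup (GL (Fin n) K)) : Prop :=
  ∀ g : GL (Fin n) K,
    (∀ f ∈ ideal G, MvPolynomial.eval (fun p => (g : Matrix _ _ K) p.1 p.2) f = 0) → g ∈ G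

/-- `G` has no proper closed subgroup of finite index. -/
def IsConnected (G : Subgroup (GL (Fin n) K)) : Prop :=
  ∀ H : Subgroup (GL (Fin n) K), IsClosed H → H ≤ G → H.relIndex G ≠ 0 → H = G

def IsUnipotent (U : Subgroup (GL (Fin n) K)) : Prop :=
  ∀ u ∈ U, IsNilpotent ((u : Matrix (Fin n) (Fin n) K) - 1)

/-- The unipotent radical is trivial. -/
def IsReductive (G : Subgroup (GL (Fin n) K)) : Prop :=
  ∀ U : Subgroup (GL (Fin n) K), IsClosed U → IsConnected U → IsUnipotent U → U ≤ G →
    (∀ g ∈ G, ∀ u ∈ U, g * u * g⁻¹ ∈ U) → U = ⊥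

/-- The Lie algebra: the tangent space at the identity. -/
def lie (G : Subgroup (GL (Fin n) K)) : Set (Matrix (Fin n) (Fin n) K) :=
  {X | ∀ f ∈ ideal G,
    ∑ p : Fin n × Fin n,
      MvPolynomial.eval (fun q => (1 : Matrix (Fin n) (Fin n) K) q.1 q.2)
        (MvPolynomial.pderiv p f) * X p.1 p.2 = 0}

/-- The character `t ↦ ∏ t_j ^ α_j` of the split torus of rank `d`. -/
def character (α : Fin d → ℤ) : (Fin d → Kˣ) →* Kˣ where
  toFun t := ∏ j, t j ^ α j
  map_one' := by simp
  map_mul' s t := by simp [mul_zpow, Finset.prod_mul_distrib]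

/-- The homomorphism `t ↦ A * diag (t ^ m_1, …, t ^ m_n) * A⁻¹` from the split torus of rank `d`
to `GL n`; every homomorphism of algebraic groups over `K` from a split torus to `GL n`
has this form. -/
def torusHom (A : GL (Fin n) K) (m : Fin n → Fin d → ℤ) : (Fin d → Kˣ) →* GL (Fin n) K :=
  (MulAut.conj A).toMonoidHom.comp
    ((Units.map (Matrix.diagonalRingHom (Fin n) K).toMonoidHom).comp
      (MulEquiv.piUnits.symm.toMonoidHom.comp (MonoidHom.pi fun i => character (m i))))

variable (F : Type*) [Field F]

/-- The inclusion of the `F`-points of `GL n` in the geometric points. -/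
def toBar : GL (Fin n) F →* GL (Fin n) (AlgebraicClosure F) :=
  Matrix.GeneralLinearGroup.map (algebraMap F (AlgebraicClosure F))

/-- `G` is defined over `F`: its ideal is generated by polynomials with coefficients in `F`. -/
def IsDefinedOver (G : Subgroup (GL (Fin n) (AlgebraicClosure F))) : Prop :=
  ideal G = Ideal.span {f | f ∈ ideal G ∧
    ∃ f₀ : MvPolynomial (Fin n × Fin n) F,
      f = MvPolynomial.map (algebraMap F (AlgebraicClosure F)) f₀}

structure IsConnectedReductive (G : Subgroup (GL (Fin n) (AlgebraicClosure F))) : Prop where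
  closed : IsClosed G
  definedOver : IsDefinedOver F G
  connected : IsConnected G
  reductive : IsReductive G

/-- A split torus over `F` in `GL n`: a homomorphism over `F` from the standard split torus which
is a closed immersion (the weights generate the character lattice). Its character and cocharacter
lattices are both identified with `Fin rank → ℤ`, the pairing being the dot product. -/
structure SplitTorus (F : Type*) [Field F] (n : ℕ) where
  rank : ℕ
  frame : GL (Fin n) F
  weight : Fin n → Fin rank → ℤ
  span_weight : Submodule.span ℤ (Set.range weight) = ⊤

variable {F}

/-- The parametrization of the geometric points of a split torus. -/
def SplitTorus.hom (S : SplitTorus F n) :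
    (Fin S.rank → (AlgebraicClosure F)ˣ) →* GL (Fin n) (AlgebraicClosure F) :=
  torusHom (toBar F S.frame) S.weight

def SplitTorus.points (S : SplitTorus F n) : Subgroup (GL (Fin n) (AlgebraicClosure F)) :=
  S.hom.range

def SplitTorus.IsMaximalIn (S : SplitTorus F n) (G : Subgroup (GL (Fin n) (AlgebraicClosure F))) :
    Prop :=
  S.points ≤ G ∧ ∀ S' : SplitTorus F n, S'.points ≤ G → S.points ≤ S'.points →
    S'.points = S.points

/-- The cocharacter of `S` with coordinates `l`. -/
def SplitTorus.cochar (S : SplitTorus F n) (l : Fin S.rank → ℤ) (t : (AlgebraicClosure F)ˣ) :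
    GL (Fin n) (AlgebraicClosure F) :=
  S.hom fun j => t ^ l j

variable (G : Subgroup (GL (Fin n) (AlgebraicClosure F))) (S : SplitTorus F n)

/-- The (relative) roots: the nonzero weights of `S` on the Lie algebra of `G`. -/
def roots : Set (Fin S.rank → ℤ) :=
  {α | α ≠ 0 ∧ ∃ X ∈ lie G, X ≠ 0 ∧ ∀ t,
    (S.hom t).val * X * ((S.hom t)⁻¹).val =
      ((character α t : (AlgebraicClosure F)ˣ) : AlgebraicClosure F) • X}

/-- `Δ` is a set of simple roots of the relative root system. -/
def IsSimpleRoots (Δ : Set (Fin S.rank → ℤ)) : Prop :=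
  Δ ⊆ roots G S ∧ LinearIndepOn ℤ id Δ ∧
    ∀ α ∈ roots G S, α ∈ AddSubmonoid.closure Δ ∨ -α ∈ AddSubmonoid.closure Δ

/-- `R` is the relative root system of `G` with respect to `S`, in the character lattice of `S`
tensored with `ℝ`. -/
def IsRelativeRootSystem {ι : Type*}
    (R : RootPairing ι ℝ (Fin S.rank → ℝ) (Fin S.rank → ℝ)) : Prop :=
  (∀ x y, R.toLinearMap x y = x ⬝ᵥ y) ∧
    Set.range R.root = (fun (α : Fin S.rank → ℤ) j => (α j : ℝ)) '' roots G S

/-- The geometric points of the centralizer `Z` of `S` in `G`. -/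
def zBar : Subgroup (GL (Fin n) (AlgebraicClosure F)) :=
  G ⊓ Subgroup.centralizer (S.points : Set (GL (Fin n) (AlgebraicClosure F)))

/-- The `F`-points of `Z`. -/
def zPts : Subgroup (GL (Fin n) F) := (zBar G S).comap (toBar F)

/-- The `F`-points of the normalizer `N_G(Z)` of `Z` in `G`. -/
def nPts : Subgroup (GL (Fin n) F) :=
  (G ⊓ Subgroup.normalizer (zBar G S : Set _)).comap (toBar F)

/-- `l(t) * g * l(t)⁻¹` extends to `t = 0` with the value `1`. -/
def ContractsToOne (l : Fin S.rank → ℤ) (g : GL (Fin n) (AlgebraicClosure F)) : Prop :=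
  ∃ Q : Matrix (Fin n) (Fin n) (Polynomial (AlgebraicClosure F)),
    (∀ t : (AlgebraicClosure F)ˣ, ∀ i j,
      (S.cochar l t * g * (S.cochar l t)⁻¹ : GL (Fin n) _) i j =
        (Q i j).eval (t : AlgebraicClosure F)) ∧
    ∀ i j, (Q i j).eval 0 = (1 : Matrix (Fin n) (Fin n) (AlgebraicClosure F)) i j

/-- The `F`-points of the root group attached to the root `α`, whose Lie algebra is the sum of the
weight spaces of the positive multiples of `α`: the elements contracted by every cocharacter
which is positive on `α`. -/
def rootGroup (α : Fin S.rank → ℤ) : Set (GL (Fin n) F) :=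
  {g | toBar F g ∈ G ∧ ∀ l : Fin S.rank → ℤ, 0 < α ⬝ᵥ l → ContractsToOne S l (toBar F g)}

/-- For a set `D` of simple roots with standard parabolic subgroup `P` and Levi subgroup `M`,
the subgroup of `M(F)` generated by the `F`-points of the unipotent radicals of the parabolic
subgroups of `M`: it is generated by the root groups of the roots in the span of `D`. -/
def leviPrime (D : Set (Fin S.rank → ℤ)) : Subgroup (GL (Fin n) F) :=
  Subgroup.closure (⋃ α ∈ roots G S ∩ (Submodule.span ℤ D : Set (Fin S.rank → ℤ)),
    rootGroup G S α)

/-- The `F`-points of the standard Levi subgroup `M` attached to the set `D` of simple roots. -/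
def leviPts (D : Set (Fin S.rank → ℤ)) : Subgroup (GL (Fin n) F) :=
  zPts G S ⊔ leviPrime G S D

variable {G S}

theorem conj_mem_zPts {g z : GL (Fin n) F} (hg : g ∈ nPts G S) (hz : z ∈ zPts G S) :
    g * z * g⁻¹ ∈ zPts G S := by
  have h := (Subgroup.mem_normalizer_iff.1 hg.2 (toBar F z)).1 hz
  simpa [zPts] using h

theorem zPts_le_nPts : zPts G S ≤ nPts G S := fun _ hz =>
  ⟨hz.1, Subgroup.le_normalizer hz⟩

variable (G S)

/-! ### The parahoric subgroup of `Z` and its pro-`p` radical -/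

variable [ValuativeRel F]

variable (F) in
/-- The maximal unramified extension of the local field `F`, generated by the roots of unity
of order prime to the residue characteristic. -/
def unramified : IntermediateField F (AlgebraicClosure F) :=
  IntermediateField.adjoin F {ζ | ∃ m : ℕ, (m : 𝓀[F]) ≠ 0 ∧ ζ ^ m = 1}

/-- For a finite separable extension `E` of `L = unramified F` and a cocharacter
`μ = torusHom A m` over `E` of the group `Z` which commutes with its conjugates over `L`, one has
the homomorphism `Res_{E/L} 𝔾ₘ → Z` over `L`, given on `L`-points by
`u ↦ ∏ τ(μ)(τ(u))` over the `L`-embeddings `τ` of `E`.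
This is the set of the images of the elements of the unit groups `𝓞_E^×` under all
these homomorphisms. -/
def inducedUnits (Z : Subgroup (GL (Fin n) (AlgebraicClosure F))) :
    Set (GL (Fin n) (AlgebraicClosure F)) :=
  {g | ∃ (E : IntermediateField (unramified F) (AlgebraicClosure F)),
    FiniteDimensional (unramified F) E ∧ Algebra.IsSeparable (unramified F) E ∧
    ∃ (A : GL (Fin n) E) (m : Fin n → Fin 1 → ℤ),
      let μ : (E →ₐ[unramified F] AlgebraicClosure F) → (AlgebraicClosure F)ˣ →
          GL (Fin n) (AlgebraicClosure F) := fun τ t =>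
        torusHom (Matrix.GeneralLinearGroup.map τ.toRingHom A) m (fun _ => t)
      (∀ τ t, μ τ t ∈ Z) ∧ (∀ τ σ t s, Commute (μ τ t) (μ σ s)) ∧
      ∃ u : Eˣ,
        IsIntegral 𝒪[F] ((u : E) : AlgebraicClosure F) ∧
        IsIntegral 𝒪[F] (((u⁻¹ : Eˣ) : E) : AlgebraicClosure F) ∧
        ∃ l : List (E →ₐ[unramified F] AlgebraicClosure F), l.Nodup ∧ (∀ τ, τ ∈ l) ∧
          g = (l.map fun τ => μ τ (Units.map τ.toRingHom.toMonoidHom u)).prod}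

/-- The kernel of the Kottwitz homomorphism `Z(L) → π₁(Z)_I` over `L = unramified F`. It is
generated by the commutators of `Z(L)` and by the images of the unit groups of the induced tori
over `L` (that is, the bounded elements of these tori, where the Kottwitz homomorphism is the
valuation). -/
def kottwitzKernel (Z : Subgroup (GL (Fin n) (AlgebraicClosure F))) :
    Subgroup (GL (Fin n) (AlgebraicClosure F)) :=
  Subgroup.closure
    ({g | ∃ a b : GL (Fin n) (unramified F),
        Matrix.GeneralLinearGroup.map (algebraMap _ (AlgebraicClosure F)) a ∈ Z ∧
        Matrix.GeneralLinearGroup.map (algebraMap _ (AlgebraicClosure F)) b ∈ Z ∧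
        g = Matrix.GeneralLinearGroup.map (algebraMap _ (AlgebraicClosure F)) (a * b * a⁻¹ * b⁻¹)} ∪
      inducedUnits Z)

/-- The unique parahoric subgroup `Z⁰` of `Z(F)`: the intersection with the kernel of the
Kottwitz homomorphism. -/
def parahoric : Subgroup (GL (Fin n) F) :=
  zPts G S ⊓ (kottwitzKernel (zBar G S)).comap (toBar F)

variable {G S}

theorem torusHom_mul {K : Type*} [Field K] {d : ℕ} (B A : GL (Fin n) K) (m : Fin n → Fin d → ℤ)
    (t : Fin d → Kˣ) : torusHom (B * A) m t = B * torusHom A m t * B⁻¹ := by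
  simp [torusHom, mul_assoc]

theorem conj_prod {M : Type*} [Group M] {α : Type*} (b : M) (f : α → M) (l : List α) :
    b * (l.map f).prod * b⁻¹ = (l.map fun x => b * f x * b⁻¹).prod := by
  induction l with
  | nil => simp
  | cons x l ih =>
    rw [List.map_cons, List.map_cons, List.prod_cons, List.prod_cons, ← ih]
    group

theorem conj_mem_kottwitzKernel {Z : Subgroup (GL (Fin n) (AlgebraicClosure F))}
    {g : GL (Fin n) F} (hg : ∀ z ∈ Z, toBar F g * z * (toBar F g)⁻¹ ∈ Z)
    {x : GL (Fin n) (AlgebraicClosure F)} (hx : x ∈ kottwitzKernel Z) :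
    toBar F g * x * (toBar F g)⁻¹ ∈ kottwitzKernel Z := by
  induction hx using Subgroup.closure_induction with
  | one => simp
  | mul a b _ _ ha hb =>
    have := Subgroup.mul_mem _ ha hb
    simpa [mul_assoc] using this
  | inv a _ ha =>
    have := Subgroup.inv_mem _ ha
    simpa [mul_assoc] using this
  | mem x hx =>
    apply Subgroup.subset_closure
    rcases hx with ⟨a, b, ha, hb, rfl⟩ | ⟨E, h1, h2, A, m, h3, h4, u, h5, h6, l, h7, h8, rfl⟩
    · left
      have key : toBar F g = Matrix.GeneralLinearGroup.map
          (algebraMap (unramified F) (AlgebraicClosure F))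
          (Matrix.GeneralLinearGroup.map (algebraMap F (unramified F)) g) := by
        ext i j; rfl
      set g' := Matrix.GeneralLinearGroup.map (n := Fin n) (algebraMap F (unramified F)) g
      refine ⟨g' * a * g'⁻¹, g' * b * g'⁻¹, ?_, ?_, ?_⟩
      · have := hg _ ha
        rw [key] at this
        simpa using this
      · have := hg _ hb
        rw [key] at this
        simpa using this
      · rw [key]
        simp [mul_assoc]
    · right
      have key : ∀ τ : E →ₐ[unramified F] AlgebraicClosure F,
          Matrix.GeneralLinearGroup.map (n := Fin n) τ.toRingHom
            (Matrix.GeneralLinearGroup.map ((algebraMap (unramified F) E).comp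
              (algebraMap F (unramified F))) g) = toBar F g := by
        intro τ
        ext i j
        exact τ.commutes (algebraMap F (unramified F) (g i j))
      refine ⟨E, h1, h2, Matrix.GeneralLinearGroup.map ((algebraMap (unramified F) E).comp
              (algebraMap F (unramified F))) g * A, m, ?_, ?_, u, h5, h6, l, h7, h8, ?_⟩
      · intro τ t
        simp only [map_mul, key, torusHom_mul]
        exact hg _ (h3 τ t)
      · intro τ σ t s
        simp only [map_mul, key, torusHom_mul]
        have := (h4 τ σ t s).map (MulAut.conj (toBar F g))
        simpa using this
      · simp only [map_mul, key, torusHom_mul]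
        rw [conj_prod]

theorem conj_mem_parahoric {g z : GL (Fin n) F} (hg : g ∈ nPts G S) (hz : z ∈ parahoric G S) :
    g * z * g⁻¹ ∈ parahoric G S := by
  refine ⟨conj_mem_zPts hg hz.1, ?_⟩
  have := conj_mem_kottwitzKernel (g := g)
    (fun z hz => (Subgroup.mem_normalizer_iff.1 hg.2 z).1 hz) hz.2
  simpa using this

variable (G S) [TopologicalSpace F]

/-- The pro-`p` radical `Z(1)` of `Z⁰`, generated by the normal subgroups of `Z⁰` all of whose
elements `h` satisfy `h ^ (p ^ k) → 1`. -/
def proRadical : Subgroup (GL (Fin n) F) :=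
  Subgroup.closure {h | ∃ H : Subgroup (GL (Fin n) F), h ∈ H ∧ H ≤ parahoric G S ∧
    (∀ z ∈ parahoric G S, ∀ x ∈ H, z * x * z⁻¹ ∈ H) ∧
    ∀ x ∈ H, Filter.Tendsto (fun k : ℕ => x ^ (ringChar 𝓀[F] ^ k)) Filter.atTop (𝓝 1)}

variable {G S}

theorem proRadical_le : proRadical G S ≤ parahoric G S := by
  refine (Subgroup.closure_le _).2 ?_
  rintro h ⟨H, hh, hle, -⟩
  exact hle hh

theorem conj_mem_proRadical [IsNonarchimedeanLocalField F] {g x : GL (Fin n) F}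
    (hg : g ∈ nPts G S) (hx : x ∈ proRadical G S) : g * x * g⁻¹ ∈ proRadical G S := by
  induction hx using Subgroup.closure_induction with
  | one => simp
  | mul a b _ _ ha hb =>
    have := Subgroup.mul_mem _ ha hb
    simpa [mul_assoc] using this
  | inv a _ ha =>
    have := Subgroup.inv_mem _ ha
    simpa [mul_assoc] using this
  | mem x hx =>
    obtain ⟨H, hxH, hle, hn, ht⟩ := hx
    apply Subgroup.subset_closure
    refine ⟨H.map (MulAut.conj g).toMonoidHom, ⟨x, hxH, by simp⟩, ?_, ?_, ?_⟩
    · rintro _ ⟨y, hy, rfl⟩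
      exact conj_mem_parahoric hg (hle hy)
    · rintro z hz _ ⟨y, hy, rfl⟩
      refine ⟨(g⁻¹ * z * g) * y * (g⁻¹ * z * g)⁻¹, hn _ ?_ y hy, ?_⟩
      · simpa using conj_mem_parahoric (Subgroup.inv_mem _ hg) hz
      · simp [mul_assoc]
    · rintro _ ⟨y, hy, rfl⟩
      have h1 : Continuous fun w : GL (Fin n) F => g * w * g⁻¹ := by fun_prop
      have h2 := (h1.tendsto 1).comp (ht y hy)
      simp only [mul_one, mul_inv_cancel] at h2
      refine h2.congr fun k => ?_
      simp [conj_pow]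

/-! ### The Iwahori-Weyl groups -/

variable (G S) [IsNonarchimedeanLocalField F]

instance parahoric_normal : ((parahoric G S).subgroupOf (nPts G S)).Normal :=
  ⟨fun _ hx g => conj_mem_parahoric g.2 hx⟩

instance proRadical_normal : ((proRadical G S).subgroupOf (nPts G S)).Normal :=
  ⟨fun _ hx g => conj_mem_proRadical g.2 hx⟩

/-- `W = N(F) / Z⁰`. -/
abbrev IW : Type _ := nPts G S ⧸ (parahoric G S).subgroupOf (nPts G S)

/-- `W(1) = N(F) / Z(1)`. -/
abbrev IWOne : Type _ := nPts G S ⧸ (proRadical G S).subgroupOf (nPts G S)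

/-- The projection `W(1) → W`. -/
def proj : IWOne G S →* IW G S :=
  QuotientGroup.map _ _ (MonoidHom.id _) fun _ hx => proRadical_le hx

/-- The image of `H ∩ N(F)` in `W`. -/
def img (H : Subgroup (GL (Fin n) F)) : Subgroup (IW G S) :=
  (H.subgroupOf (nPts G S)).map (QuotientGroup.mk' _)

/-- The image of `H ∩ N(F)` in `W(1)`. -/
def imgOne (H : Subgroup (GL (Fin n) F)) : Subgroup (IWOne G S) :=
  (H.subgroupOf (nPts G S)).map (QuotientGroup.mk' _)

theorem img_mono {H K : Subgroup (GL (Fin n) F)} (h : H ≤ K) : img G S H ≤ img G S K :=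
  Subgroup.map_mono fun _ hx => h hx

theorem imgOne_mono {H K : Subgroup (GL (Fin n) F)} (h : H ≤ K) : imgOne G S H ≤ imgOne G S K :=
  Subgroup.map_mono fun _ hx => h hx

theorem proj_mem_img {H : Subgroup (GL (Fin n) F)} {w : IWOne G S} (hw : w ∈ imgOne G S H) :
    proj G S w ∈ img G S H := by
  obtain ⟨x, hx, rfl⟩ := hw
  exact ⟨x, hx, rfl⟩

theorem parahoric_le_leviPts (D : Set (Fin S.rank → ℤ)) : parahoric G S ≤ leviPts G S D :=
  inf_le_left.trans le_sup_left

/-! ### The datum of a standard Levi subgroup `M` -/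

variable (D D₂ : Set (Fin S.rank → ℤ))

/-- `W_P`. -/
abbrev LeviW : Type _ := img G S (leviPts G S D)

/-- `W_P(1)`. -/
abbrev LeviWOne : Type _ := imgOne G S (leviPts G S D)

/-- `W_{aff,P}`. -/
abbrev LeviAff : Type _ := img G S (leviPrime G S D)

/-- `Z_κ = Z⁰ / Z(1)`. -/
abbrev ZKappa : Type _ := imgOne G S (parahoric G S)

def leviI : LeviAff G S D →* LeviW G S D := Subgroup.inclusion (img_mono G S le_sup_right)

def leviIota : ZKappa G S →* LeviWOne G S D :=
  Subgroup.inclusion (imgOne_mono G S (parahoric_le_leviPts G S D))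

def leviProj : LeviWOne G S D →* LeviW G S D :=
  ((proj G S).comp (Subgroup.subtype _)).codRestrict _ fun w => proj_mem_img G S w.2

variable {D} in
/-- `Ω_P`, the group of the elements of length `0` with respect to the set `S_{aff,P}` of simple
reflections, that is, of the elements which normalize this set. -/
def leviOmega (Saff : Set (LeviAff G S D)) : Subgroup (LeviW G S D) :=
  Subgroup.normalizer (leviI G S D '' Saff)

/-! ### The quotients -/

/-- `Λ ∩ W_{aff,P₂}`, as a subgroup of `W_P`, where `Λ` is the image of `Z(F)`. -/
def latticeK : Subgroup (LeviW G S D) :=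
  (img G S (zPts G S) ⊓ img G S (leviPrime G S D₂)).subgroupOf _

/-- `Λ(1) ∩ W_{aff,P₂}(1)`, as a subgroup of `W_P(1)`, where `Λ(1)` is the image of `Z(F)`. -/
def latticeKOne : Subgroup (LeviWOne G S D) :=
  (imgOne G S (zPts G S) ⊓ imgOne G S (leviPrime G S D₂)).subgroupOf _

/-- `Z_κ ∩ W_{aff,P₂}(1)`, as a subgroup of `Z_κ`. -/
def kappaK : Subgroup (ZKappa G S) :=
  (imgOne G S (leviPrime G S D₂)).subgroupOf _

/-- The embedding of `W'_aff = W_{aff,P}` in `W' = W_P / (Λ ∩ W_{aff,P₂})`. -/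
def quotI [(latticeK G S D D₂).Normal] : LeviAff G S D →* LeviW G S D ⧸ latticeK G S D D₂ :=
  (QuotientGroup.mk' _).comp (leviI G S D)

variable {D} in
/-- The embedding of `Ω' = Ω_P / (Λ ∩ W_{aff,P₂})` in `W'`. -/
def quotJ [(latticeK G S D D₂).Normal] (Saff : Set (LeviAff G S D)) :
    (leviOmega G S Saff ⧸ (latticeK G S D D₂).subgroupOf (leviOmega G S Saff)) →*
      LeviW G S D ⧸ latticeK G S D D₂ :=
  QuotientGroup.map _ _ (leviOmega G S Saff).subtype le_rfl

/-- The embedding of `Z'_κ = Z_κ / (Z_κ ∩ W_{aff,P₂}(1))` in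
`W'(1) = W_P(1) / (Λ(1) ∩ W_{aff,P₂}(1))`. -/
def quotIota [(latticeKOne G S D D₂).Normal] [(kappaK G S D₂).Normal] :
    (ZKappa G S ⧸ kappaK G S D₂) →* LeviWOne G S D ⧸ latticeKOne G S D D₂ :=
  QuotientGroup.map _ _ (leviIota G S D) fun z hz =>
    ⟨imgOne_mono G S inf_le_left z.2, hz⟩

/-- The projection `W'(1) → W'`. -/
def quotProj [(latticeK G S D D₂).Normal] [(latticeKOne G S D D₂).Normal] :
    (LeviWOne G S D ⧸ latticeKOne G S D D₂) →* LeviW G S D ⧸ latticeK G S D D₂ :=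
  QuotientGroup.map _ _ (leviProj G S D) fun _ hw =>
    ⟨proj_mem_img G S hw.1, proj_mem_img G S hw.2⟩

variable {D} in
/-- The ideal `I` of `H_P` generated by the elements `T_λ - 1` with
`λ ∈ Λ(1) ∩ W_{aff,P₂}(1)`. -/
def heckeIdeal {C H : Type*} [CommRing C] [Ring H] [Algebra C H]
    (T : Module.Basis (LeviWOne G S D) C H) : TwoSidedIdeal H :=
  TwoSidedIdeal.span {x | ∃ w ∈ latticeKOne G S D D₂, x = T w - 1}

end AlgGrp

end

noncomputable section

namespace AlgGrp

/-! ### Weights of matrices under a diagonal torus -/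

section Weights

variable {K : Type*} [Field K] {n d : ℕ}

/-! The group-theoretic core is that `M_P'` and `M_{P₂}'` commute elementwise
(`commute_of_mem_leviPrime`). Take `g`, `h` in root groups of roots `α` in the span of `D` and `β`
in the span of `Δ \ D`. Independence of `Δ` provides a cocharacter positive on `α` and zero on `β`,
and another with the roles exchanged. In an eigenbasis of `S`, being contracted means that `g - 1`
has only weights positive on the first cocharacter, while those of `h` are nonnegative on it. So the
commutator `x` of `g` and `h` has all weights of `x - 1` positive on the first cocharacter and, by
symmetry, on the second. If `x ≠ 1`, its leading term along a generic cocharacter is a weight vector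
in the Lie algebra (`exists_mem_roots_of_isPositive`), which yields a root involving both `D` and `Δ
\ D`. Reflections in `D` exclude such a root (`not_mixed_root`).

Since `Z⁰ ⊆ Z(F)`, every element of `Λ ∩ W_{aff,P₂}` has a representative in `Z(F) ∩ M_{P₂}'`. As
`M_P(F) = Z(F) M_P'`, where `Z(F)` normalizes `M_{P₂}'` and `M_P'` centralizes it, this subgroup is
normal in `W_P`. It centralizes `W_{aff,P}`, so it lies in `Ω_P`, and it is the image of its
analogue in `W(1)`.

The rest is formal, for a normal subgroup `K ≤ Ω` of `W`, a normal subgroup `K₁` of `W(1)` with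
image `K`, and `Kz = K₁ ∩ Z_κ`. Then `W_aff` embeds in `W ⧸ K` and lengths do not change. Two lifts
of the same reflection element differ by an element of `Kz`, so `c` descends. The `T k` with `k ∈
K₁` have length `0`, so the ideal generated by the `T k - 1` lies in the span of the `T (w * k) - T
w`, which dies when coordinates are summed over cosets. This gives the basis of the quotient
(`IsHeckeAlgebra.exists_basis_quotient`).

Finally, `W_P = Λ W_{aff,P}` and `Λ` is commutative, because commutators of `Z(F)` lie in `Z⁰`.
Hence `Ω_P`, which embeds in `W_P ⧸ W_{aff,P}`, is commutative. -/

theorem character_sub (a b : Fin d → ℤ) (t : Fin d → Kˣ) :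
    character (a - b) t = character a t * (character b t)⁻¹ := by
  simp [character, zpow_sub, Finset.prod_mul_distrib]

theorem character_zpow (a l : Fin d → ℤ) (t : Kˣ) :
    character a (fun j => t ^ l j) = t ^ (a ⬝ᵥ l) := by
  simp only [character, MonoidHom.coe_mk, OneHom.coe_mk, dotProduct, ← zpow_mul]
  induction (Finset.univ : Finset (Fin d)) using Finset.induction_on with
  | empty => simp
  | insert i s hi ih => rw [Finset.prod_insert hi, Finset.sum_insert hi, zpow_add, ih, mul_comm (l i)]

theorem torusHom_val (A : GL (Fin n) K) (m : Fin n → Fin d → ℤ) (t : Fin d → Kˣ) :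
    (torusHom A m t).val =
      A.val * Matrix.diagonal (fun i => ((character (m i) t : Kˣ) : K)) * (A⁻¹).val := rfl

theorem torusHom_inv_val (A : GL (Fin n) K) (m : Fin n → Fin d → ℤ) (t : Fin d → Kˣ) :
    ((torusHom A m t)⁻¹).val =
      A.val * Matrix.diagonal (fun i => (((character (m i) t)⁻¹ : Kˣ) : K)) * (A⁻¹).val := by
  rw [← map_inv, torusHom_val]
  simp only [map_inv]

/-- In the eigenbasis given by `A`, the elementary matrix at `(i, j)` has weight `m i - m j`. -/
theorem torusHom_conj (A : GL (Fin n) K) (m : Fin n → Fin d → ℤ) (t : Fin d → Kˣ)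
    (E : Matrix (Fin n) (Fin n) K) :
    (torusHom A m t).val * (A.val * E * (A⁻¹).val) * ((torusHom A m t)⁻¹).val =
      A.val * Matrix.of (fun i j => ((character (m i - m j) t : Kˣ) : K) * E i j) *
        (A⁻¹).val := by
  have h : (A⁻¹).val * A.val = 1 := by simp
  rw [torusHom_val, torusHom_inv_val]
  have : Matrix.of (fun i j => ((character (m i - m j) t : Kˣ) : K) * E i j) =
      Matrix.diagonal (fun i => ((character (m i) t : Kˣ) : K)) * E *
        Matrix.diagonal (fun i => (((character (m i) t)⁻¹ : Kˣ) : K)) := by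
    ext i j
    rw [Matrix.mul_diagonal, Matrix.diagonal_mul, Matrix.of_apply, character_sub, Units.val_mul]
    ring
  rw [this]
  calc _ = A.val * Matrix.diagonal (fun i => ((character (m i) t : Kˣ) : K)) *
        ((A⁻¹).val * A.val) * E * ((A⁻¹).val * A.val) *
        Matrix.diagonal (fun i => (((character (m i) t)⁻¹ : Kˣ) : K)) * (A⁻¹).val := by
        simp only [mul_assoc]
    _ = _ := by rw [h]; simp only [mul_assoc, mul_one]

/-- All weights of `Y` pair positively with the cocharacter `l`. -/
def IsPositive (m : Fin n → Fin d → ℤ) (l : Fin d → ℤ) (Y : Matrix (Fin n) (Fin n) K) : Prop :=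
  ∀ i j, Y i j ≠ 0 → 0 < (m i - m j) ⬝ᵥ l

/-- All weights of `Y` pair nonnegatively with the cocharacter `l`. -/
def IsNonneg (m : Fin n → Fin d → ℤ) (l : Fin d → ℤ) (Y : Matrix (Fin n) (Fin n) K) : Prop :=
  ∀ i j, Y i j ≠ 0 → 0 ≤ (m i - m j) ⬝ᵥ l

variable {m : Fin n → Fin d → ℤ} {l : Fin d → ℤ} {Y V : Matrix (Fin n) (Fin n) K}

theorem IsPositive.mul_isNonneg (hY : IsPositive m l Y) (hV : IsNonneg m l V) :
    IsPositive m l (Y * V) := by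
  intro i j h
  obtain ⟨k, -, hk⟩ := Finset.exists_ne_zero_of_sum_ne_zero (by rwa [Matrix.mul_apply] at h)
  have h1 := hY i k (left_ne_zero_of_mul hk)
  have h2 := hV k j (right_ne_zero_of_mul hk)
  have : m i - m j = (m i - m k) + (m k - m j) := by abel
  rw [this, add_dotProduct]
  omega

theorem IsNonneg.mul_isPositive (hY : IsNonneg m l Y) (hV : IsPositive m l V) :
    IsPositive m l (Y * V) := by
  intro i j h
  obtain ⟨k, -, hk⟩ := Finset.exists_ne_zero_of_sum_ne_zero (by rwa [Matrix.mul_apply] at h)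
  have h1 := hY i k (left_ne_zero_of_mul hk)
  have h2 := hV k j (right_ne_zero_of_mul hk)
  have : m i - m j = (m i - m k) + (m k - m j) := by abel
  rw [this, add_dotProduct]
  omega

theorem IsNonneg.mul (hY : IsNonneg m l Y) (hV : IsNonneg m l V) : IsNonneg m l (Y * V) := by
  intro i j h
  obtain ⟨k, -, hk⟩ := Finset.exists_ne_zero_of_sum_ne_zero (by rwa [Matrix.mul_apply] at h)
  have h1 := hY i k (left_ne_zero_of_mul hk)
  have h2 := hV k j (right_ne_zero_of_mul hk)
  have : m i - m j = (m i - m k) + (m k - m j) := by abel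
  rw [this, add_dotProduct]
  omega

theorem IsPositive.sub (hY : IsPositive m l Y) (hV : IsPositive m l V) :
    IsPositive m l (Y - V) := by
  intro i j h
  by_cases h0 : Y i j = 0
  · refine hV i j fun h1 => h ?_
    simp [h0, h1]
  · exact hY i j h0

theorem isNonneg_one : IsNonneg m l (1 : Matrix (Fin n) (Fin n) K) := by
  intro i j h
  by_cases hij : i = j
  · simp [hij]
  · exact (h (Matrix.one_apply_ne hij)).elim

theorem isNonneg_of_sub_one (hY : IsNonneg m l (Y - 1)) : IsNonneg m l Y := by
  intro i j h
  by_cases h0 : (Y - 1) i j = 0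
  · rw [Matrix.sub_apply, sub_eq_zero] at h0
    exact isNonneg_one i j (by rwa [← h0])
  · exact hY i j h0

/-- Nonnegativity is block triangularity for the indices ordered by `-(m i ⬝ᵥ l)`, and the inverse
inherits it. -/
theorem IsNonneg.inv {Y : GL (Fin n) K} (hY : IsNonneg m l Y.val) :
    IsNonneg m l (Y⁻¹).val := by
  have h : Y.val.BlockTriangular (fun i => -(m i ⬝ᵥ l)) := by
    intro i j hij
    by_contra h
    have := hY i j h
    rw [sub_dotProduct] at this
    simp only at hij
    omega
  have := Y.invertible
  have h2 := Matrix.blockTriangular_inv_of_blockTriangular h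
  intro i j h3
  rw [Matrix.coe_units_inv] at h3
  by_contra h4
  rw [sub_dotProduct] at h4
  exact h3 (h2 (by simp only; omega))

/-- The difference is `(YV - VY) Y⁻¹V⁻¹`, and `YV - VY` does not change when `Y` is replaced by the
positive matrix `Y - 1`. -/
theorem isPositive_commutator_left {Y V : GL (Fin n) K} (hY : IsPositive m l (Y.val - 1))
    (hV : IsNonneg m l V.val) : IsPositive m l ((Y * V * Y⁻¹ * V⁻¹).val - 1) := by
  have hY' : IsNonneg m l Y.val := isNonneg_of_sub_one fun i j h => (hY i j h).le
  have h1 : (Y * V * Y⁻¹ * V⁻¹).val - 1 =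
      ((Y.val - 1) * V.val - V.val * (Y.val - 1)) * ((Y⁻¹).val * (V⁻¹).val) := by
    have h2 : (Y.val - 1) * V.val - V.val * (Y.val - 1) = (Y * V).val - (V * Y).val := by
      simp only [Units.val_mul]; noncomm_ring
    rw [h2, ← Units.val_mul, sub_mul, ← Units.val_mul, ← Units.val_mul]
    congr 1
    · congr 1; group
    · rw [show V * Y * (Y⁻¹ * V⁻¹) = 1 by group]; simp
  rw [h1]
  exact ((hY.mul_isNonneg hV).sub (hV.mul_isPositive hY)).mul_isNonneg (hY'.inv.mul hV.inv)

theorem isPositive_commutator_right {Y V : GL (Fin n) K} (hV : IsPositive m l (V.val - 1))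
    (hY : IsNonneg m l Y.val) : IsPositive m l ((Y * V * Y⁻¹ * V⁻¹).val - 1) := by
  have hV' : IsNonneg m l V.val := isNonneg_of_sub_one fun i j h => (hV i j h).le
  have h1 : (Y * V * Y⁻¹ * V⁻¹).val - 1 =
      (Y.val * (V.val - 1) - (V.val - 1) * Y.val) * ((Y⁻¹).val * (V⁻¹).val) := by
    have h2 : Y.val * (V.val - 1) - (V.val - 1) * Y.val = (Y * V).val - (V * Y).val := by
      simp only [Units.val_mul]; noncomm_ring
    rw [h2, ← Units.val_mul, sub_mul, ← Units.val_mul, ← Units.val_mul]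
    congr 1
    · congr 1; group
    · rw [show V * Y * (Y⁻¹ * V⁻¹) = 1 by group]; simp
  rw [h1]
  exact ((hY.mul_isPositive hV).sub (hV.mul_isNonneg hY)).mul_isNonneg (hY.inv.mul hV'.inv)

/-- If the Laurent monomial `y * t ^ k` with `k ≤ 0` extends to a polynomial whose value `e` at `0`
is not `y`, then `k < 0` and `e ≠ 0`. -/
theorem neg_of_zpow_mul_eq_eval [Infinite K] {k : ℤ} {y : K} {P : Polynomial K} {e : K}
    (h : ∀ t : Kˣ, ((t ^ k : Kˣ) : K) * y = P.eval (t : K)) (he : P.eval 0 = e)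
    (hy : y ≠ e) (hk : k ≤ 0) : k < 0 ∧ e ≠ 0 := by
  obtain ⟨a, rfl⟩ : ∃ a : ℕ, k = -a := ⟨k.natAbs, by omega⟩
  have h1 : Polynomial.C y = Polynomial.X ^ a * P := by
    apply Polynomial.eq_of_infinite_eval_eq
    refine Set.Infinite.mono (s := {t | t ≠ 0}) ?_
      (Set.Finite.infinite_compl (Set.finite_singleton 0))
    intro t ht
    have := h (Units.mk0 t ht)
    simp only [zpow_neg, zpow_natCast, Units.val_inv_eq_inv_val, Units.val_pow_eq_pow_val,
      Units.val_mk0] at this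
    have ht' : t ^ a ≠ 0 := pow_ne_zero a ht
    simp only [Set.mem_ofPred_eq, Polynomial.eval_C, Polynomial.eval_mul, Polynomial.eval_pow,
      Polynomial.eval_X, ← this]
    field_simp
  have h2 := congrArg (Polynomial.eval 0) h1
  simp only [Polynomial.eval_C, Polynomial.eval_mul, Polynomial.eval_pow, Polynomial.eval_X,
    he] at h2
  rcases Nat.eq_zero_or_pos a with rfl | ha
  · simp at h2
    exact (hy h2).elim
  · rw [zero_pow ha.ne', zero_mul] at h2
    refine ⟨by omega, fun h => hy (h2.trans h.symm)⟩

end Weights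

/-! ### Contracted elements in the eigenbasis of `S` -/

variable {F : Type*} [Field F] {n : ℕ} {G : Subgroup (GL (Fin n) (AlgebraicClosure F))}
  {S : SplitTorus F n}

/-- The element `g` in the basis of eigenvectors of `S`. -/
def SplitTorus.inFrame (S : SplitTorus F n) :
    GL (Fin n) (AlgebraicClosure F) →* GL (Fin n) (AlgebraicClosure F) :=
  (MulAut.conj (toBar F S.frame)⁻¹).toMonoidHom

theorem SplitTorus.inFrame_val (S : SplitTorus F n) (g : GL (Fin n) (AlgebraicClosure F)) :
    (S.inFrame g).val = ((toBar F S.frame)⁻¹).val * g.val * (toBar F S.frame).val := by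
  simp [SplitTorus.inFrame, mul_assoc]

theorem SplitTorus.val_eq_inFrame (S : SplitTorus F n) (g : GL (Fin n) (AlgebraicClosure F)) :
    g.val = (toBar F S.frame).val * (S.inFrame g).val * ((toBar F S.frame)⁻¹).val := by
  rw [S.inFrame_val, ← Units.val_mul, ← Units.val_mul, ← Units.val_mul, ← Units.val_mul]
  congr 1
  group

theorem SplitTorus.cochar_conj_val (S : SplitTorus F n) (l : Fin S.rank → ℤ)
    (t : (AlgebraicClosure F)ˣ) (g : GL (Fin n) (AlgebraicClosure F)) :
    (S.cochar l t * g * (S.cochar l t)⁻¹).val = (toBar F S.frame).val *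
      Matrix.of (fun i j => ((t ^ ((S.weight i - S.weight j) ⬝ᵥ l) : (AlgebraicClosure F)ˣ) :
        AlgebraicClosure F) * (S.inFrame g).val i j) * ((toBar F S.frame)⁻¹).val := by
  rw [Units.val_mul, Units.val_mul, S.val_eq_inFrame g]
  have := torusHom_conj (toBar F S.frame) S.weight (fun j => t ^ l j) (S.inFrame g).val
  simp only [character_zpow] at this
  exact this

/-- Conjugation by `l(t)` multiplies the entry `(i, j)` in the eigenbasis by `t` to the power
`(weight i - weight j) ⬝ᵥ l`. When this exponent is not positive, a polynomial limit equal to the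
entry of `1` forces the entry itself to be that of `1`. -/
theorem ContractsToOne.isPositive {l : Fin S.rank → ℤ} {g : GL (Fin n) (AlgebraicClosure F)}
    (h : ContractsToOne S l g) : IsPositive S.weight l ((S.inFrame g).val - 1) := by
  obtain ⟨Q, h1, h2⟩ := h
  set B := toBar F S.frame
  let P : Matrix (Fin n) (Fin n) (Polynomial (AlgebraicClosure F)) :=
    (B⁻¹).val.map Polynomial.C * Q * B.val.map Polynomial.C
  have hP : ∀ a, P.map (Polynomial.eval a) = (B⁻¹).val * Q.map (Polynomial.eval a) * B.val := by
    intro a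
    have h3 : ∀ M : Matrix (Fin n) (Fin n) (AlgebraicClosure F),
        (M.map Polynomial.C).map (Polynomial.evalRingHom a) = M := by
      intro M; ext i j; simp
    have : P.map (Polynomial.evalRingHom a) =
        (B⁻¹).val * Q.map (Polynomial.evalRingHom a) * B.val := by
      simp only [P, Matrix.map_mul, h3]
    exact this
  intro i j hij
  by_contra hk
  have key := neg_of_zpow_mul_eq_eval (k := (S.weight i - S.weight j) ⬝ᵥ l)
    (y := (S.inFrame g).val i j) (P := P i j) (e := (1 : Matrix _ _ _) i j) ?_ ?_ ?_ (by omega)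
  · have : i = j := by
      by_contra h
      exact key.2 (Matrix.one_apply_ne h)
    subst this
    simp at key
  · intro t
    have h3 : Q.map (Polynomial.eval (t : AlgebraicClosure F)) =
        (S.cochar l t * g * (S.cochar l t)⁻¹).val := by
      ext i j; exact (h1 t i j).symm
    have h4 := hP t
    rw [h3, S.cochar_conj_val] at h4
    have h5 : (B⁻¹).val * B.val = 1 := by simp
    have h6 : ∀ M : Matrix (Fin n) (Fin n) (AlgebraicClosure F),
        (B⁻¹).val * (B.val * M * (B⁻¹).val) * B.val = M := by
      intro M
      calc _ = ((B⁻¹).val * B.val) * M * ((B⁻¹).val * B.val) := by simp only [mul_assoc]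
        _ = M := by rw [h5]; simp
    rw [h6] at h4
    exact (congrFun (congrFun h4 i) j).symm
  · have h3 : Q.map (Polynomial.eval 0) = 1 := by
      ext i j; exact h2 i j
    have h4 := hP 0
    rw [h3] at h4
    have h5 : (B⁻¹).val * B.val = 1 := by simp
    rw [mul_one, h5] at h4
    exact congrFun (congrFun h4 i) j
  · intro h
    exact hij (by rw [Matrix.sub_apply, h, sub_self])

theorem isPositive_of_mem_rootGroup {α l : Fin S.rank → ℤ} {g : GL (Fin n) F}
    (hg : g ∈ rootGroup G S α) (hl : 0 < α ⬝ᵥ l) :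
    IsPositive S.weight l ((S.inFrame (toBar F g)).val - 1) :=
  (hg.2 l hl).isPositive

/-- Suppose a weight `w` of `g - 1` has `w ⬝ᵥ l < 0`, and let `N = w ⬝ᵥ l' > 0`. Then `l' + N • l`
is still positive on `α`, yet its pairing with `w` is `N (1 + w ⬝ᵥ l) ≤ 0`. -/
theorem isNonneg_of_mem_rootGroup {α l l' : Fin S.rank → ℤ} {g : GL (Fin n) F}
    (hg : g ∈ rootGroup G S α) (hl : α ⬝ᵥ l = 0) (hl' : 0 < α ⬝ᵥ l') :
    IsNonneg S.weight l (S.inFrame (toBar F g)).val := by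
  refine isNonneg_of_sub_one fun i j hij => ?_
  by_contra hneg
  have h1 := isPositive_of_mem_rootGroup hg hl' i j hij
  have h2 := isPositive_of_mem_rootGroup (l := l' + ((S.weight i - S.weight j) ⬝ᵥ l') • l) hg
    (by rw [dotProduct_add, dotProduct_smul, hl]; simpa) i j hij
  rw [dotProduct_add, dotProduct_smul, smul_eq_mul] at h2
  nlinarith

theorem isPositive_commutator_of_mem_rootGroup {α β l l' : Fin S.rank → ℤ} {g h : GL (Fin n) F}
    (hg : g ∈ rootGroup G S α) (hh : h ∈ rootGroup G S β)
    (hl : 0 < α ⬝ᵥ l) (hl0 : β ⬝ᵥ l = 0) (hl' : 0 < β ⬝ᵥ l') :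
    IsPositive S.weight l ((S.inFrame (toBar F (g * h * g⁻¹ * h⁻¹))).val - 1) := by
  simp only [map_mul, map_inv]
  exact isPositive_commutator_left (isPositive_of_mem_rootGroup hg hl)
    (isNonneg_of_mem_rootGroup hh hl0 hl')

theorem isPositive_commutator_of_mem_rootGroup' {α β l l' : Fin S.rank → ℤ} {g h : GL (Fin n) F}
    (hg : g ∈ rootGroup G S α) (hh : h ∈ rootGroup G S β)
    (hl : 0 < β ⬝ᵥ l) (hl0 : α ⬝ᵥ l = 0) (hl' : 0 < α ⬝ᵥ l') :
    IsPositive S.weight l ((S.inFrame (toBar F (g * h * g⁻¹ * h⁻¹))).val - 1) := by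
  simp only [map_mul, map_inv]
  exact isPositive_commutator_right (isPositive_of_mem_rootGroup hh hl)
    (isNonneg_of_mem_rootGroup hg hl0 hl')

/-! ### Leading terms of contracted elements lie in the Lie algebra -/

/-- First-order Taylor expansion, used below with `A` a polynomial ring in `t` and `ε = t ^ k`. -/
theorem exists_aeval_add_mul {σ K A : Type*} [Fintype σ] [CommRing K] [CommRing A]
    [Algebra K A] (f : MvPolynomial σ K) (a y : σ → A) (ε : A) :
    ∃ r, MvPolynomial.aeval (fun p => a p + ε * y p) f = MvPolynomial.aeval a f +
      ε * ∑ p, MvPolynomial.aeval a (MvPolynomial.pderiv p f) * y p + ε ^ 2 * r := by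
  classical
  induction f using MvPolynomial.induction_on with
  | C c => exact ⟨0, by simp⟩
  | add f g hf hg =>
    obtain ⟨r, hr⟩ := hf
    obtain ⟨s, hs⟩ := hg
    refine ⟨r + s, ?_⟩
    simp only [map_add, hr, hs, add_mul, Finset.sum_add_distrib]
    ring
  | mul_X f i hf =>
    obtain ⟨r, hr⟩ := hf
    refine ⟨(∑ p, MvPolynomial.aeval a (MvPolynomial.pderiv p f) * y p) * y i +
      r * (a i + ε * y i), ?_⟩
    have : ∑ p, MvPolynomial.aeval a (MvPolynomial.pderiv p (f * MvPolynomial.X i)) * y p =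
        (∑ p, MvPolynomial.aeval a (MvPolynomial.pderiv p f) * y p) * a i +
          MvPolynomial.aeval a f * y i := by
      simp only [MvPolynomial.pderiv_mul, MvPolynomial.pderiv_X, map_add, map_mul,
        MvPolynomial.aeval_X, add_mul, Finset.sum_add_distrib, Finset.sum_mul]
      congr 1
      · exact Finset.sum_congr rfl fun p _ => by ring
      · rw [Finset.sum_eq_single i]
        · simp
        · intro p _ hp
          simp [Pi.single_eq_of_ne' hp]
        · simp
    rw [this, map_mul, map_mul, hr, MvPolynomial.aeval_X, MvPolynomial.aeval_X]
    ring

/-- A product of nonzero linear forms is a nonzero polynomial, so some integer point is not a zero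
of it. -/
theorem exists_dotProduct_ne_zero {d : ℕ} (s : Finset (Fin d → ℤ)) (hs : ∀ δ ∈ s, δ ≠ 0) :
    ∃ l : Fin d → ℤ, ∀ δ ∈ s, δ ⬝ᵥ l ≠ 0 := by
  classical
  let f : (Fin d → ℤ) → MvPolynomial (Fin d) ℤ := fun δ =>
    ∑ j, MvPolynomial.C (δ j) * MvPolynomial.X j
  have hf : ∀ δ l, MvPolynomial.eval l (f δ) = δ ⬝ᵥ l := by
    intro δ l
    simp [f, dotProduct]
  have h0 : ∏ δ ∈ s, f δ ≠ 0 := by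
    rw [Finset.prod_ne_zero_iff]
    intro δ hδ h
    apply hs δ hδ
    ext j
    have := hf δ (Pi.single j 1)
    rw [h] at this
    simpa using this.symm
  by_contra! h
  apply h0
  apply MvPolynomial.funext
  intro l
  obtain ⟨δ, hδ, h1⟩ := h l
  rw [map_prod, map_zero]
  exact Finset.prod_eq_zero hδ ((hf δ l).trans h1)

theorem exists_pos_and_dotProduct_ne_zero {d : ℕ} (s t : Finset (Fin d → ℤ))
    (hs : ∀ δ ∈ s, δ ≠ 0) {l₀ : Fin d → ℤ} (ht : ∀ γ ∈ t, 0 < γ ⬝ᵥ l₀) :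
    ∃ l : Fin d → ℤ, (∀ δ ∈ s, δ ⬝ᵥ l ≠ 0) ∧ ∀ γ ∈ t, 0 < γ ⬝ᵥ l := by
  classical
  obtain ⟨l₁, h1⟩ := exists_dotProduct_ne_zero s hs
  -- `N` exceeds every `|γ ⬝ᵥ l₁|`, so adding `l₁` to `N • l₀` neither cancels a nonzero multiple of
  -- `N` nor spoils a positive one.
  let N : ℤ := 1 + ∑ γ ∈ s ∪ t, |γ ⬝ᵥ l₁|
  have hN : ∀ γ ∈ s ∪ t, |γ ⬝ᵥ l₁| < N := by
    intro γ hγ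
    have := Finset.single_le_sum (f := fun γ => |γ ⬝ᵥ l₁|) (fun _ _ => abs_nonneg _) hγ
    simp only [N]
    omega
  refine ⟨N • l₀ + l₁, fun δ hδ h => ?_, fun γ hγ => ?_⟩
  · have h2 := hN δ (Finset.mem_union_left _ hδ)
    rw [dotProduct_add, dotProduct_smul, smul_eq_mul] at h
    rw [abs_lt] at h2
    rcases lt_trichotomy (δ ⬝ᵥ l₀) 0 with h3 | h3 | h3
    · nlinarith
    · rw [h3, mul_zero, zero_add] at h
      exact h1 δ hδ h
    · nlinarith
  · have h2 := hN γ (Finset.mem_union_right _ hγ)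
    have h3 := ht γ hγ
    rw [dotProduct_add, dotProduct_smul, smul_eq_mul]
    rw [abs_lt] at h2
    nlinarith

variable {F : Type*} [Field F] {n : ℕ} {G : Subgroup (GL (Fin n) (AlgebraicClosure F))}
  {S : SplitTorus F n}

/-- If `l(t) x l(t)⁻¹ = B (1 + t ^ k * Y(t)) B⁻¹` with `Y` polynomial and `k > 0`, then
`B Y(0) B⁻¹` lies in the Lie algebra. -/
theorem mem_lie_of_curve {k : ℕ} (hk : 0 < k)
    (Y : Matrix (Fin n) (Fin n) (Polynomial (AlgebraicClosure F)))
    (hY : ∀ t : (AlgebraicClosure F)ˣ, ∃ g ∈ G, ∀ i j,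
      (g : GL (Fin n) (AlgebraicClosure F)).val i j = (1 : Matrix _ _ (AlgebraicClosure F)) i j +
        (t : AlgebraicClosure F) ^ k * (Y i j).eval (t : AlgebraicClosure F)) :
    Y.map (Polynomial.eval 0) ∈ lie G := by
  intro f hf
  let a : Fin n × Fin n → Polynomial (AlgebraicClosure F) := fun p =>
    Polynomial.C ((1 : Matrix (Fin n) (Fin n) (AlgebraicClosure F)) p.1 p.2)
  let y : Fin n × Fin n → Polynomial (AlgebraicClosure F) := fun p => Y p.1 p.2
  have ev : ∀ (g : MvPolynomial (Fin n × Fin n) (AlgebraicClosure F))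
      (b : Fin n × Fin n → Polynomial (AlgebraicClosure F)) (t : AlgebraicClosure F),
      (MvPolynomial.aeval b g).eval t = MvPolynomial.eval (fun p => (b p).eval t) g := by
    intro g b t
    have h1 : MvPolynomial.eval (fun p => (b p).eval t) g =
        MvPolynomial.aeval (fun p => (b p).eval t) g := by
      rw [MvPolynomial.aeval_eq_eval]
    rw [h1, ← Polynomial.coe_aeval_eq_eval]
    have := MvPolynomial.comp_aeval_apply (R := AlgebraicClosure F) b (Polynomial.aeval t) g
    simpa using this
  obtain ⟨r, hr⟩ := exists_aeval_add_mul f a y (Polynomial.X ^ k)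
  have h1 : MvPolynomial.aeval a f = 0 := by
    have hC : MvPolynomial.aeval a f = Polynomial.C (MvPolynomial.eval
        (fun p => (1 : Matrix (Fin n) (Fin n) (AlgebraicClosure F)) p.1 p.2) f) := by
      apply Polynomial.funext
      intro t
      rw [ev]
      simp [a]
    rw [hC, show MvPolynomial.eval
        (fun p => (1 : Matrix (Fin n) (Fin n) (AlgebraicClosure F)) p.1 p.2) f = 0 from
        hf 1 G.one_mem, map_zero]
  -- `f` vanishes on the curve for all `t ≠ 0`, hence identically in `t`.
  have h2 : MvPolynomial.aeval (fun p => a p + Polynomial.X ^ k * y p) f = 0 := by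
    apply Polynomial.eq_of_infinite_eval_eq
    refine Set.Infinite.mono (s := {t | t ≠ 0}) ?_
      (Set.Finite.infinite_compl (Set.finite_singleton 0))
    intro t ht
    obtain ⟨g, hg, hg'⟩ := hY (Units.mk0 t ht)
    rw [Set.mem_ofPred_eq, ev, Polynomial.eval_zero]
    have := hf g hg
    simp only [hg', Units.val_mk0] at this
    simpa [a, y] using this
  rw [h1, h2, zero_add] at hr
  -- After cancelling `t ^ k` and setting `t = 0`, only the differential of `f` at `1` in the
  -- direction `Y(0)` remains.
  have h3 : Polynomial.X ^ k * ((∑ p, MvPolynomial.aeval a (MvPolynomial.pderiv p f) * y p) +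
      Polynomial.X ^ k * r) = 0 := by
    rw [hr]; ring
  have h4 := (mul_eq_zero.1 h3).resolve_left (pow_ne_zero _ Polynomial.X_ne_zero)
  have h5 := congrArg (Polynomial.eval 0) h4
  simp only [Polynomial.eval_add, Polynomial.eval_mul, Polynomial.eval_pow, Polynomial.eval_X,
    zero_pow hk.ne', zero_mul, add_zero, Polynomial.eval_zero, Polynomial.eval_finsetSum, ev] at h5
  simpa [a, y] using h5

/-- Conjugation by a suitable `l(t)` turns `x` into a curve `1 + t ^ k * Y(t)` in `G`, with `k` the
least exponent occurring in `x - 1`. If `l` separates the weights, `Y(0)` is a single weight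
component of `x - 1`, and `mem_lie_of_curve` places it in the Lie algebra. -/
theorem exists_mem_roots_of_isPositive (hS : S.points ≤ G)
    {x : GL (Fin n) (AlgebraicClosure F)} (hx : x ∈ G) (hx1 : x ≠ 1) {l₀ : Fin S.rank → ℤ}
    (hl₀ : IsPositive S.weight l₀ ((S.inFrame x).val - 1)) :
    ∃ i j, ((S.inFrame x).val - 1) i j ≠ 0 ∧ S.weight i - S.weight j ∈ roots G S := by
  classical
  set B := toBar F S.frame with hB
  set X := (S.inFrame x).val - 1 with hX
  let wt : Fin n × Fin n → Fin S.rank → ℤ := fun p => S.weight p.1 - S.weight p.2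
  let supp : Finset (Fin n × Fin n) := Finset.univ.filter fun p => X p.1 p.2 ≠ 0
  -- `l` is positive on the weights of `x - 1` and separates distinct weights.
  obtain ⟨l, hl1, hl2⟩ := exists_pos_and_dotProduct_ne_zero
    ((Finset.univ.image fun pq : (Fin n × Fin n) × (Fin n × Fin n) =>
      wt pq.1 - wt pq.2).filter (· ≠ 0)) (supp.image wt) (by simp) (l₀ := l₀) (by
      intro γ hγ
      obtain ⟨p, hp, rfl⟩ := Finset.mem_image.1 hγ
      exact hl₀ _ _ (Finset.mem_filter.1 hp).2)
  have hinj : ∀ p q, wt p ⬝ᵥ l = wt q ⬝ᵥ l → wt p = wt q := by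
    intro p q h
    by_contra hne
    refine hl1 (wt p - wt q) (Finset.mem_filter.2 ⟨Finset.mem_image.2 ⟨(p, q), by simp, rfl⟩,
      sub_ne_zero.2 hne⟩) ?_
    rw [sub_dotProduct, h, sub_self]
  have hpos : ∀ p ∈ supp, 0 < wt p ⬝ᵥ l := fun p hp => hl2 _ (Finset.mem_image_of_mem _ hp)
  have hne : supp.Nonempty := by
    by_contra hemp
    rw [Finset.not_nonempty_iff_eq_empty] at hemp
    have hX0 : X = 0 := by
      ext i j
      by_contra h
      have : (i, j) ∈ supp := by simpa [supp] using h
      simp [hemp] at this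
    rw [hX, sub_eq_zero] at hX0
    apply hx1
    ext1
    rw [S.val_eq_inFrame x, hX0]
    simp
  obtain ⟨p₀, hp₀, hmin⟩ := supp.exists_min_image (fun p => wt p ⬝ᵥ l) hne
  set k : ℕ := (wt p₀ ⬝ᵥ l).toNat with hkdef
  have hk : (k : ℤ) = wt p₀ ⬝ᵥ l := Int.toNat_of_nonneg (hpos p₀ hp₀).le
  have hk0 : 0 < k := by have := hpos p₀ hp₀; omega
  -- The truncated subtraction is harmless: where it truncates, `X i j = 0`, since `k` is the
  -- minimum over the support.
  let Y₀ : Matrix (Fin n) (Fin n) (Polynomial (AlgebraicClosure F)) := Matrix.of fun i j =>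
    Polynomial.C (X i j) * Polynomial.X ^ (((wt (i, j)) ⬝ᵥ l).toNat - k)
  let Y : Matrix (Fin n) (Fin n) (Polynomial (AlgebraicClosure F)) :=
    B.val.map Polynomial.C * Y₀ * (B⁻¹).val.map Polynomial.C
  have hYt : ∀ a, Y.map (Polynomial.eval a) =
      B.val * Y₀.map (Polynomial.eval a) * (B⁻¹).val := by
    intro a
    have h3 : ∀ M : Matrix (Fin n) (Fin n) (AlgebraicClosure F),
        (M.map Polynomial.C).map (Polynomial.evalRingHom a) = M := by
      intro M; ext i j; simp
    have : Y.map (Polynomial.evalRingHom a) =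
        B.val * Y₀.map (Polynomial.evalRingHom a) * (B⁻¹).val := by
      simp only [Y, Matrix.map_mul, h3]
    exact this
  have hcochar : ∀ t, S.cochar l t ∈ G := fun t => hS ⟨_, rfl⟩
  have hlie := mem_lie_of_curve (G := G) hk0 Y fun t => by
    refine ⟨S.cochar l t * x * (S.cochar l t)⁻¹,
      G.mul_mem (G.mul_mem (hcochar t) hx) (G.inv_mem (hcochar t)), ?_⟩
    have key : (S.cochar l t * x * (S.cochar l t)⁻¹).val =
        1 + (t : AlgebraicClosure F) ^ k • Y.map (Polynomial.eval (t : AlgebraicClosure F)) := by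
      rw [S.cochar_conj_val, hYt]
      have h1 : (Matrix.of fun i j => ((t ^ ((S.weight i - S.weight j) ⬝ᵥ l) :
          (AlgebraicClosure F)ˣ) : AlgebraicClosure F) * (S.inFrame x).val i j) =
          1 + (t : AlgebraicClosure F) ^ k • Y₀.map (Polynomial.eval (t : AlgebraicClosure F)) := by
        ext i j
        have h2 : (S.inFrame x).val i j = (1 : Matrix _ _ (AlgebraicClosure F)) i j + X i j := by
          rw [hX, Matrix.sub_apply]; ring
        simp only [Matrix.of_apply, Matrix.add_apply, Matrix.smul_apply, Matrix.map_apply, Y₀,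
          Polynomial.eval_mul, Polynomial.eval_C, Polynomial.eval_pow, Polynomial.eval_X,
          smul_eq_mul]
        rw [h2, mul_add]
        congr 1
        · by_cases hij : i = j
          · subst hij; simp
          · simp [Matrix.one_apply_ne hij]
        · by_cases h0 : X i j = 0
          · simp [h0]
          · have hm : (i, j) ∈ supp := by simpa [supp] using h0
            have hp := hpos _ hm
            have hle := hmin _ hm
            obtain ⟨e, he, hn⟩ : ∃ e, (wt (i, j) ⬝ᵥ l).toNat - k = e ∧
                (S.weight i - S.weight j) ⬝ᵥ l = ((k + e : ℕ) : ℤ) := by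
              refine ⟨_, rfl, ?_⟩
              change wt (i, j) ⬝ᵥ l = _
              omega
            rw [he, hn, zpow_natCast, pow_add, Units.val_mul, Units.val_pow_eq_pow_val,
              Units.val_pow_eq_pow_val]
            ring
      rw [h1, ← hB]
      simp [mul_add, add_mul]
    intro i j
    rw [key]
    simp
  set E : Matrix (Fin n) (Fin n) (AlgebraicClosure F) := Y₀.map (Polynomial.eval 0) with hE
  have hE0 : ∀ i j, E i j ≠ 0 → wt (i, j) = wt p₀ := by
    intro i j hij
    have hX0 : X i j ≠ 0 := by
      intro h
      simp [hE, Y₀, h] at hij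
    have hm : (i, j) ∈ supp := by simpa [supp] using hX0
    apply hinj
    by_contra hne
    have hle := hmin _ hm
    have : (wt (i, j) ⬝ᵥ l).toNat - k ≠ 0 := by omega
    simp [hE, Y₀, this] at hij
  have hEp : E p₀.1 p₀.2 ≠ 0 := by
    have : (wt (p₀.1, p₀.2) ⬝ᵥ l).toNat - k = 0 := by
      change (wt p₀ ⬝ᵥ l).toNat - k = 0
      omega
    have h2 : X p₀.1 p₀.2 ≠ 0 := (Finset.mem_filter.1 hp₀).2
    simpa [hE, Y₀, this] using h2
  rw [hYt] at hlie
  refine ⟨p₀.1, p₀.2, (Finset.mem_filter.1 hp₀).2, fun h => ?_, _, hlie, fun h => hEp ?_, ?_⟩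
  · have := hpos p₀ hp₀
    simp only [wt] at this
    rw [h] at this
    simp at this
  · have h1 : (B⁻¹).val * B.val = 1 := by simp
    have h2 : E = (B⁻¹).val * (B.val * E * (B⁻¹).val) * B.val := by
      symm
      calc _ = ((B⁻¹).val * B.val) * E * ((B⁻¹).val * B.val) := by simp only [mul_assoc]
        _ = E := by rw [h1]; simp
    rw [h2, h]
    simp
  · intro t
    have := torusHom_conj B S.weight t E
    refine this.trans ?_
    rw [← Matrix.smul_mul, ← Matrix.mul_smul]
    congr 2
    ext i j
    simp only [Matrix.of_apply, Matrix.smul_apply, smul_eq_mul]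
    change _ * E i j = _ * E i j
    by_cases h0 : E i j = 0
    · rw [h0, mul_zero, mul_zero]
    · have := hE0 i j h0
      simp only [wt] at this
      rw [this]

/-! ### Root systems with two orthogonal sets of simple roots -/

/-- Over `ℚ`, some linear form is `1` on `Δ ∩ D` and `0` on the rest of the independent set `Δ`;
clearing denominators turns it into a cocharacter. -/
theorem exists_cochar_of_linearIndepOn {d : ℕ} {Δ : Set (Fin d → ℤ)}
    (hΔ : LinearIndepOn ℤ id Δ) {D : Set (Fin d → ℤ)} :
    ∃ l : Fin d → ℤ, (∀ δ ∈ Δ ∩ D, 0 < δ ⬝ᵥ l) ∧ ∀ δ ∈ Δ \ D, δ ⬝ᵥ l = 0 := by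
  classical
  let e : (Fin d → ℤ) →ₗ[ℤ] (Fin d → ℚ) :=
    LinearMap.pi fun j => (Algebra.linearMap ℤ ℚ) ∘ₗ LinearMap.proj j
  have he : ∀ γ j, e γ j = (γ j : ℚ) := fun _ _ => rfl
  have hker : LinearMap.ker e = ⊥ := by
    rw [LinearMap.ker_eq_bot']
    intro γ h
    ext j
    have := congrFun h j
    rw [he] at this
    simpa using this
  have h1 : LinearIndependent ℚ (fun δ : Δ => e δ) :=
    (LinearIndependent.iff_fractionRing ℤ ℚ).1 (LinearIndependent.map' hΔ e hker)
  let g : (Submodule.span ℚ (Set.range fun δ : Δ => e δ)) →ₗ[ℚ] ℚ :=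
    (Finsupp.linearCombination ℚ fun δ : Δ => if (δ : Fin d → ℤ) ∈ D then (1 : ℚ) else 0) ∘ₗ
      h1.repr
  obtain ⟨f, hf⟩ := LinearMap.exists_extend g
  have hfδ : ∀ δ (hδ : δ ∈ Δ), f (e δ) = if δ ∈ D then 1 else 0 := by
    intro δ hδ
    have h2 : e δ ∈ Submodule.span ℚ (Set.range fun δ : Δ => e δ) :=
      Submodule.subset_span ⟨⟨δ, hδ⟩, rfl⟩
    have h3 : f (e δ) = g ⟨e δ, h2⟩ := by rw [← hf]; rfl
    rw [h3]
    simp only [g, LinearMap.comp_apply]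
    rw [h1.repr_eq_single ⟨δ, hδ⟩ ⟨e δ, h2⟩ rfl]
    simp
  obtain ⟨b, hb⟩ := IsLocalization.exist_integer_multiples_of_finite (nonZeroDivisors ℤ)
    fun j : Fin d => f (Pi.single j 1)
  choose l hl using hb
  have hb0 : (b : ℤ) ≠ 0 := nonZeroDivisors.ne_zero b.2
  -- The common denominator `b` may be negative; a second factor `b` replaces it by `b ^ 2`.
  have key : ∀ γ : Fin d → ℤ, ((γ ⬝ᵥ ((b : ℤ) • l) : ℤ) : ℚ) = (b : ℚ) ^ 2 * f (e γ) := by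
    intro γ
    have h4 : e γ = ∑ j, (γ j : ℚ) • (Pi.single j 1 : Fin d → ℚ) := by
      ext i
      rw [Finset.sum_apply, he]
      simp [Pi.single_apply]
    rw [h4, map_sum, dotProduct_smul, dotProduct, smul_eq_mul]
    push_cast
    rw [Finset.mul_sum, Finset.mul_sum]
    refine Finset.sum_congr rfl fun j _ => ?_
    have := hl j
    simp only [algebraMap_int_eq, eq_intCast, zsmul_eq_mul] at this
    rw [this, map_smul, smul_eq_mul]
    ring
  refine ⟨(b : ℤ) • l, fun δ hδ => ?_, fun δ hδ => ?_⟩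
  · have := key δ
    rw [hfδ δ hδ.1, if_pos hδ.2] at this
    have h5 : (0 : ℚ) < (b : ℚ) ^ 2 * 1 := by
      have : ((b : ℤ) : ℚ) ≠ 0 := by exact_mod_cast hb0
      positivity
    rw [← this] at h5
    exact_mod_cast h5
  · have := key δ
    rw [hfδ δ hδ.1, if_neg hδ.2, mul_zero] at this
    exact_mod_cast this

theorem dotProduct_eq_zero_of_mem_closure {d : ℕ} {D : Set (Fin d → ℤ)} {l : Fin d → ℤ}
    (hl : ∀ δ ∈ D, δ ⬝ᵥ l = 0) {γ : Fin d → ℤ} (hγ : γ ∈ AddSubmonoid.closure D) :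
    γ ⬝ᵥ l = 0 := by
  induction hγ using AddSubmonoid.closure_induction with
  | mem x hx => exact hl x hx
  | zero => simp
  | add x y _ _ hx hy => rw [add_dotProduct, hx, hy, add_zero]

theorem dotProduct_nonneg_of_mem_closure {d : ℕ} {D : Set (Fin d → ℤ)} {l : Fin d → ℤ}
    (hl : ∀ δ ∈ D, 0 ≤ δ ⬝ᵥ l) {γ : Fin d → ℤ} (hγ : γ ∈ AddSubmonoid.closure D) :
    0 ≤ γ ⬝ᵥ l := by
  induction hγ using AddSubmonoid.closure_induction with
  | mem x hx => exact hl x hx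
  | zero => simp
  | add x y _ _ hx hy => rw [add_dotProduct]; omega

theorem eq_zero_or_dotProduct_pos_of_mem_closure {d : ℕ} {D : Set (Fin d → ℤ)} {l : Fin d → ℤ}
    (hl : ∀ δ ∈ D, 0 < δ ⬝ᵥ l) {γ : Fin d → ℤ} (hγ : γ ∈ AddSubmonoid.closure D) :
    γ = 0 ∨ 0 < γ ⬝ᵥ l := by
  induction hγ using AddSubmonoid.closure_induction with
  | mem x hx => exact Or.inr (hl x hx)
  | zero => exact Or.inl rfl
  | add x y _ _ hx hy =>
    rw [add_dotProduct]
    rcases hx with rfl | hx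
    · simpa using hy
    · rcases hy with rfl | hy
      · simpa using Or.inr hx
      · right; omega

/-- The inclusion of the character lattice in the real vector space. -/
def realVec (d : ℕ) : (Fin d → ℤ) →+ (Fin d → ℝ) where
  toFun γ j := γ j
  map_zero' := by ext; simp
  map_add' a b := by ext; simp

theorem realVec_injective (d : ℕ) : Function.Injective (realVec d) := by
  intro a b h
  ext j
  have := congrFun h j
  simpa [realVec] using this

section Orthogonal

variable {ι : Type*} [Finite ι] {M N : Type*} [AddCommGroup M] [Module ℝ M]
  [AddCommGroup N] [Module ℝ N] (R : RootPairing ι ℝ M N) [R.IsCrystallographic]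

/-- Descent on `f γ` for a positive root `γ = a + b`. The invariant form is positive on nonzero
vectors of the root span and `A` is orthogonal to `B`, so some `δ ∈ A` pairs positively with `γ`.
Reflecting in `δ` lowers `f` and keeps `g`, so the new root is again positive. If `f` has reached
`0`, the new root lies in the cone of `B` and is orthogonal to `δ`, although a reflection in `δ`
only changes the sign of the pairing with `δ`. -/
theorem not_mixed_root {L : Type*} [AddCommGroup L] {e : L →+ M} (he : Function.Injective e)
    {A B : Set L} (hA : ∀ δ ∈ A, ∃ i, R.root i = e δ) (hB : ∀ δ ∈ B, ∃ i, R.root i = e δ)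
    (hR : ∀ i, ∃ γ, R.root i = e γ ∧
      (γ ∈ AddSubmonoid.closure (A ∪ B) ∨ -γ ∈ AddSubmonoid.closure (A ∪ B)))
    (orth : ∀ i j, ∀ α ∈ A, ∀ β ∈ B, R.root i = e α → R.root j = e β → R.pairing i j = 0)
    {f g : L →+ ℤ} (hfA : ∀ δ ∈ A, 0 < f δ) (hfB : ∀ δ ∈ B, f δ = 0)
    (hgA : ∀ δ ∈ A, g δ = 0) (hgB : ∀ δ ∈ B, 0 < g δ)
    (k : ℕ) (i : ι) (γ : L) (hi : R.root i = e γ)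
    (hγ : γ ∈ AddSubmonoid.closure (A ∪ B)) (hk : f γ = k) (hf : 0 < f γ) (hg : 0 < g γ) :
    False := by
  classical
  have := Fintype.ofFinite ι
  have hclf : ∀ x ∈ AddSubmonoid.closure (A ∪ B), 0 ≤ f x := by
    intro x hx
    induction hx using AddSubmonoid.closure_induction with
    | mem x hx => exact hx.elim (fun h => (hfA x h).le) (fun h => (hfB x h).ge)
    | zero => simp
    | add x y _ _ hx hy => rw [map_add]; omega
  have hclg : ∀ x ∈ AddSubmonoid.closure (A ∪ B), 0 ≤ g x := by
    intro x hx
    induction hx using AddSubmonoid.closure_induction with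
    | mem x hx => exact hx.elim (fun h => (hgA x h).ge) (fun h => (hgB x h).le)
    | zero => simp
    | add x y _ _ hx hy => rw [map_add]; omega
  have hfA' : ∀ x ∈ AddSubmonoid.closure A, x = 0 ∨ 0 < f x := by
    intro x hx
    induction hx using AddSubmonoid.closure_induction with
    | mem x hx => exact Or.inr (hfA x hx)
    | zero => exact Or.inl rfl
    | add x y _ _ hx hy =>
      rcases hx with rfl | hx
      · simpa using hy
      · rcases hy with rfl | hy
        · simpa using Or.inr hx
        · right; rw [map_add]; omega
  have hfB' : ∀ x ∈ AddSubmonoid.closure B, f x = 0 := by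
    intro x hx
    induction hx using AddSubmonoid.closure_induction with
    | mem x hx => exact hfB x hx
    | zero => simp
    | add x y _ _ hx hy => rw [map_add, hx, hy, add_zero]
  induction k using Nat.strong_induction_on generalizing i γ with
  | _ k ih =>
  have hdec := hγ
  rw [AddSubmonoid.closure_union, AddSubmonoid.mem_sup] at hdec
  obtain ⟨a, ha, b, hb, rfl⟩ := hdec
  have ha0 : a ≠ 0 := by
    rintro rfl
    rw [zero_add, hfB' b hb] at hf
    exact lt_irrefl _ hf
  let Q := R.RootForm
  have hQ : ∀ i j, 2 * Q (R.root i) (R.root j) = R.pairing i j * Q (R.root j) (R.root j) :=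
    R.toInvariantForm.two_mul_apply_root_root
  have hQpos : ∀ j, 0 < Q (R.root j) (R.root j) := fun j =>
    R.rootForm_pos_of_ne_zero (Submodule.subset_span ⟨j, rfl⟩) (R.ne_zero j)
  have hQAB : ∀ α ∈ A, ∀ β ∈ B, Q (e β) (e α) = 0 := by
    intro α hα β hβ
    obtain ⟨j, hj⟩ := hA α hα
    obtain ⟨j', hj'⟩ := hB β hβ
    have h1 := hQ j' j
    rw [RootPairing.pairing_eq_zero_iff.1 (orth j j' α hα β hβ hj hj'), zero_mul, hj, hj'] at h1
    linarith
  have hQb : ∀ α ∈ A, ∀ x ∈ AddSubmonoid.closure B, Q (e x) (e α) = 0 := by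
    intro α hα x hx
    induction hx using AddSubmonoid.closure_induction with
    | mem x hx => exact hQAB α hα x hx
    | zero => simp
    | add x y _ _ hx hy => rw [map_add, map_add, LinearMap.add_apply, hx, hy, add_zero]
  have hspan : ∀ x ∈ AddSubmonoid.closure A, e x ∈ R.rootSpan ℝ := by
    intro x hx
    induction hx using AddSubmonoid.closure_induction with
    | mem x hx =>
      obtain ⟨j, hj⟩ := hA x hx
      exact Submodule.subset_span ⟨j, hj⟩
    | zero => simp
    | add x y _ _ hx hy => rw [map_add]; exact Submodule.add_mem _ hx hy
  have hQaa : 0 < Q (e a) (e a) :=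
    R.rootForm_pos_of_ne_zero (hspan a ha) fun h => ha0 (he (h.trans (map_zero e).symm))
  -- Otherwise `Q (e a)` would be nonpositive on the whole cone of `A`, in particular at `a`.
  obtain ⟨δ, hδ, hδpos⟩ : ∃ δ ∈ A, 0 < Q (e a) (e δ) := by
    by_contra! hcon
    have : ∀ x ∈ AddSubmonoid.closure A, Q (e a) (e x) ≤ 0 := by
      intro x hx
      induction hx using AddSubmonoid.closure_induction with
      | mem x hx => exact hcon x hx
      | zero => simp
      | add x y _ _ hx hy => rw [map_add, map_add]; linarith
    exact absurd (this a ha) (not_le.2 hQaa)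
  obtain ⟨j, hj⟩ := hA δ hδ
  have hpos : 0 < R.pairing i j := by
    have h1 := hQ i j
    have h2 : Q (R.root i) (R.root j) = Q (e a) (e δ) := by
      rw [hi, hj, map_add, map_add, LinearMap.add_apply, hQb δ hδ b hb, add_zero]
    have h3 := hQpos j
    by_contra hcon
    have : R.pairing i j * Q (R.root j) (R.root j) ≤ 0 :=
      mul_nonpos_of_nonpos_of_nonneg (not_lt.1 hcon) h3.le
    linarith
  obtain ⟨p, hp⟩ := RootPairing.IsValuedIn.exists_value (P := R) (S := ℤ) i j
  simp only [algebraMap_int_eq, eq_intCast] at hp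
  have hp0 : 0 < p := by rw [← hp] at hpos; exact_mod_cast hpos
  have hrefl : R.root (R.reflectionPerm j i) = e ((a + b) - p • δ) := by
    rw [R.root_reflectionPerm, R.reflection_apply_root, ← hp, hi, hj, map_sub, map_zsmul,
      Int.cast_smul_eq_zsmul]
  set γ' := (a + b) - p • δ with hγ'
  have hfγ' : f γ' = f (a + b) - p * f δ := by rw [hγ', map_sub, map_zsmul, smul_eq_mul]
  have hgγ' : g γ' = g (a + b) := by
    rw [hγ', map_sub, map_zsmul, hgA δ hδ, smul_zero, sub_zero]
  -- The reflected root has the same positive value of `g`, so it cannot be negative.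
  have hcl : γ' ∈ AddSubmonoid.closure (A ∪ B) := by
    obtain ⟨γ'', h1, h2⟩ := hR (R.reflectionPerm j i)
    rw [hrefl] at h1
    rw [← he h1] at h2
    refine h2.resolve_right fun h3 => ?_
    have := hclg _ h3
    rw [map_neg] at this
    omega
  have hlt : f γ' < f (a + b) := by
    have := hfA δ hδ
    rw [hfγ']
    nlinarith
  have h0 := hclf γ' hcl
  rcases h0.lt_or_eq with h1 | h1
  · exact ih (f γ').toNat (by omega) (R.reflectionPerm j i) γ' hrefl hcl (by omega) h1 (by omega)
  -- Here `f γ' = 0`, so `γ'` has no component in `A` and the coroot of `δ` kills it.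
  · have hdec := hcl
    rw [AddSubmonoid.closure_union, AddSubmonoid.mem_sup] at hdec
    obtain ⟨a', ha', b', hb', hab⟩ := hdec
    have ha'0 : a' = 0 := by
      refine (hfA' a' ha').resolve_right fun h2 => ?_
      rw [← hab, map_add, hfB' b' hb'] at h1
      omega
    rw [ha'0, zero_add] at hab
    have h2 : ∀ x ∈ AddSubmonoid.closure B, R.coroot' j (e x) = 0 := by
      intro x hx
      induction hx using AddSubmonoid.closure_induction with
      | mem x hx =>
        obtain ⟨j', hj'⟩ := hB x hx
        rw [← hj', R.root_coroot'_eq_pairing]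
        exact RootPairing.pairing_eq_zero_iff.1 (orth j j' δ hδ x hx hj hj')
      | zero => simp
      | add x y _ _ hx hy => rw [map_add, map_add, hx, hy, add_zero]
    have h3 := h2 b' hb'
    rw [hab, ← hrefl, R.root_coroot'_eq_pairing, ← R.pairing_reflectionPerm,
      R.pairing_reflectionPerm_self_right] at h3
    linarith

end Orthogonal

/-! ### Splitting of the relative roots, and commutation of `M_P'` with `M_{P₂}'` -/

variable {F : Type*} [Field F] {n : ℕ} {G : Subgroup (GL (Fin n) (AlgebraicClosure F))}
  {S : SplitTorus F n}

theorem dotProduct_eq_zero_or_of_mem_roots {ι : Type*} [Finite ι]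
    {R : RootPairing ι ℝ (Fin S.rank → ℝ) (Fin S.rank → ℝ)} [R.IsCrystallographic]
    (hR : IsRelativeRootSystem G S R) {Δ : Set (Fin S.rank → ℤ)} (hΔ : IsSimpleRoots G S Δ)
    {D : Set (Fin S.rank → ℤ)} (hD : D ⊆ Δ)
    (orth : ∀ α ∈ D, ∀ β ∈ Δ \ D, ∀ a b : ι, (R.root a = fun k => (α k : ℝ)) →
      (R.root b = fun k => (β k : ℝ)) → R.pairing a b = 0)
    {l l' : Fin S.rank → ℤ} (hlD : ∀ δ ∈ D, 0 < δ ⬝ᵥ l) (hl : ∀ δ ∈ Δ \ D, δ ⬝ᵥ l = 0)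
    (hlD' : ∀ δ ∈ D, δ ⬝ᵥ l' = 0) (hl' : ∀ δ ∈ Δ \ D, 0 < δ ⬝ᵥ l')
    {γ : Fin S.rank → ℤ} (hγ : γ ∈ roots G S) : γ ⬝ᵥ l = 0 ∨ γ ⬝ᵥ l' = 0 := by
  have hroot : ∀ γ ∈ roots G S, ∃ i, R.root i = realVec S.rank γ := by
    intro γ hγ
    have : realVec S.rank γ ∈ Set.range R.root := by
      rw [hR.2]; exact ⟨γ, hγ, rfl⟩
    exact this
  have hun : D ∪ Δ \ D = Δ := Set.union_sdiff_cancel hD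
  have hR' : ∀ i, ∃ γ, R.root i = realVec S.rank γ ∧
      (γ ∈ AddSubmonoid.closure (D ∪ Δ \ D) ∨ -γ ∈ AddSubmonoid.closure (D ∪ Δ \ D)) := by
    intro i
    have : R.root i ∈ Set.range R.root := ⟨i, rfl⟩
    rw [hR.2] at this
    obtain ⟨γ, hγ, h⟩ := this
    rw [hun]
    exact ⟨γ, h.symm, hΔ.2.2 γ hγ⟩
  let f : (Fin S.rank → ℤ) → (Fin S.rank → ℤ) →+ ℤ := fun l =>
    { toFun := fun γ => γ ⬝ᵥ l
      map_zero' := zero_dotProduct _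
      map_add' := fun _ _ => add_dotProduct _ _ _ }
  have key : ∀ i γ, R.root i = realVec S.rank γ → γ ∈ AddSubmonoid.closure Δ →
      γ ⬝ᵥ l = 0 ∨ γ ⬝ᵥ l' = 0 := by
    intro i γ hi hγ
    by_contra! hcon
    have h1 : 0 ≤ γ ⬝ᵥ l := dotProduct_nonneg_of_mem_closure (D := Δ) (fun δ hδ => by
      by_cases h : δ ∈ D
      · exact (hlD δ h).le
      · exact (hl δ ⟨hδ, h⟩).ge) hγ
    have h2 : 0 ≤ γ ⬝ᵥ l' := dotProduct_nonneg_of_mem_closure (D := Δ) (fun δ hδ => by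
      by_cases h : δ ∈ D
      · exact (hlD' δ h).ge
      · exact (hl' δ ⟨hδ, h⟩).le) hγ
    exact not_mixed_root R (realVec_injective S.rank) (A := D) (B := Δ \ D)
      (fun δ hδ => hroot δ (hΔ.1 (hD hδ))) (fun δ hδ => hroot δ (hΔ.1 hδ.1)) hR'
      (fun i j α hα β hβ h1 h2 => orth α hα β hβ i j h1 h2) (f := f l) (g := f l')
      hlD hl hlD' hl' (γ ⬝ᵥ l).toNat i γ hi (by rwa [hun])
      (Int.toNat_of_nonneg h1).symm (lt_of_le_of_ne h1 hcon.1.symm)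
      (lt_of_le_of_ne h2 hcon.2.symm)
  obtain ⟨i, hi⟩ := hroot γ hγ
  rcases hΔ.2.2 γ hγ with h | h
  · exact key i γ hi h
  · have := key (R.reflectionPerm i i) (-γ) (by
      rw [R.root_reflectionPerm, R.reflection_apply_self, hi, map_neg]) h
    simpa using this

/-- Because `α ⬝ᵥ l' = 0`, the nonnegative expansion of `α` or `-α` in `Δ` has no term from `Δ \ D`;
what is left is a nonzero sum of elements of `D`. -/
theorem dotProduct_ne_zero_of_mem_span {Δ : Set (Fin S.rank → ℤ)} (hΔ : IsSimpleRoots G S Δ)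
    {D : Set (Fin S.rank → ℤ)} (hD : D ⊆ Δ)
    {l l' : Fin S.rank → ℤ} (hlD : ∀ δ ∈ D, 0 < δ ⬝ᵥ l)
    (hlD' : ∀ δ ∈ D, δ ⬝ᵥ l' = 0) (hl' : ∀ δ ∈ Δ \ D, 0 < δ ⬝ᵥ l')
    {α : Fin S.rank → ℤ} (hα : α ∈ roots G S) (hαD : α ∈ Submodule.span ℤ D) :
    α ⬝ᵥ l ≠ 0 ∧ α ⬝ᵥ l' = 0 := by
  have h0 : ∀ x ∈ Submodule.span ℤ D, x ⬝ᵥ l' = 0 := by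
    intro x hx
    induction hx using Submodule.span_induction with
    | mem x hx => exact hlD' x hx
    | zero => simp
    | add x y _ _ hx hy => rw [add_dotProduct, hx, hy, add_zero]
    | smul c x _ hx => rw [smul_dotProduct, hx, smul_zero]
  refine ⟨?_, h0 α hαD⟩
  have key : ∀ x ∈ AddSubmonoid.closure Δ, x ⬝ᵥ l' = 0 → x ≠ 0 → x ⬝ᵥ l ≠ 0 := by
    intro x hx hx' hx0
    rw [← Set.union_sdiff_cancel hD, AddSubmonoid.closure_union, AddSubmonoid.mem_sup] at hx
    obtain ⟨a, ha, b, hb, rfl⟩ := hx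
    rw [add_dotProduct, dotProduct_eq_zero_of_mem_closure hlD' ha, zero_add] at hx'
    have hb0 : b = 0 :=
      (eq_zero_or_dotProduct_pos_of_mem_closure hl' hb).resolve_right (by omega)
    rw [hb0, add_zero] at hx0 ⊢
    exact ((eq_zero_or_dotProduct_pos_of_mem_closure hlD ha).resolve_left hx0).ne'
  rcases hΔ.2.2 α hα with h | h
  · exact key α h (h0 α hαD) hα.1
  · have := key (-α) h (by rw [neg_dotProduct, h0 α hαD, neg_zero]) (neg_ne_zero.2 hα.1)
    simpa using this

/-- The root groups of two orthogonal Levi subgroups commute. -/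
theorem commute_of_mem_rootGroup {ι : Type*} [Finite ι] (hS : S.points ≤ G)
    {R : RootPairing ι ℝ (Fin S.rank → ℝ) (Fin S.rank → ℝ)} [R.IsCrystallographic]
    (hR : IsRelativeRootSystem G S R) {Δ : Set (Fin S.rank → ℤ)} (hΔ : IsSimpleRoots G S Δ)
    {D : Set (Fin S.rank → ℤ)} (hD : D ⊆ Δ)
    (orth : ∀ α ∈ D, ∀ β ∈ Δ \ D, ∀ a b : ι, (R.root a = fun k => (α k : ℝ)) →
      (R.root b = fun k => (β k : ℝ)) → R.pairing a b = 0)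
    {α β : Fin S.rank → ℤ} (hα : α ∈ roots G S) (hαD : α ∈ Submodule.span ℤ D)
    (hβ : β ∈ roots G S) (hβD : β ∈ Submodule.span ℤ (Δ \ D))
    {g h : GL (Fin n) F} (hg : g ∈ rootGroup G S α) (hh : h ∈ rootGroup G S β) :
    Commute g h := by
  obtain ⟨l, hlD, hl⟩ := exists_cochar_of_linearIndepOn hΔ.2.1 (D := D)
  obtain ⟨l', hl', hlD'⟩ := exists_cochar_of_linearIndepOn hΔ.2.1 (D := Δ \ D)
  rw [Set.inter_eq_right.2 hD] at hlD
  rw [Set.inter_eq_right.2 Set.sdiff_subset] at hl'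
  rw [Set.sdiff_sdiff_cancel_left hD] at hlD'
  have hαl := dotProduct_ne_zero_of_mem_span hΔ hD hlD hlD' hl' hα hαD
  have hβl := dotProduct_ne_zero_of_mem_span hΔ (D := Δ \ D) Set.sdiff_subset hl' hl
    (by rwa [Set.sdiff_sdiff_cancel_left hD]) hβ hβD
  -- `α` may be a negative root; a sign makes the cocharacter positive on it.
  obtain ⟨u, hu⟩ : ∃ u : ℤ, 0 < α ⬝ᵥ (u • l) := by
    refine ⟨SignType.sign (α ⬝ᵥ l), ?_⟩
    rw [dotProduct_smul, smul_eq_mul, sign_mul_self]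
    exact abs_pos.2 hαl.1
  obtain ⟨v, hv⟩ : ∃ v : ℤ, 0 < β ⬝ᵥ (v • l') := by
    refine ⟨SignType.sign (β ⬝ᵥ l'), ?_⟩
    rw [dotProduct_smul, smul_eq_mul, sign_mul_self]
    exact abs_pos.2 hβl.1
  have hu' : β ⬝ᵥ (u • l) = 0 := by rw [dotProduct_smul, hβl.2, smul_zero]
  have hv' : α ⬝ᵥ (v • l') = 0 := by rw [dotProduct_smul, hαl.2, smul_zero]
  -- The weights of the commutator minus `1` are positive on both `u • l` and `v • l'`; if it is
  -- nontrivial, one of them is a root, against the splitting.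
  have h1 := isPositive_commutator_of_mem_rootGroup hg hh hu hu' hv
  have h2 := isPositive_commutator_of_mem_rootGroup' hg hh hv hv' hu
  by_contra hne
  have hx1 : toBar F (g * h * g⁻¹ * h⁻¹) ≠ 1 := by
    intro h3
    apply hne
    have hinj : Function.Injective (toBar F (n := n)) :=
      Units.map_injective (Matrix.map_injective (algebraMap F (AlgebraicClosure F)).injective)
    have h4 := hinj (h3.trans (map_one _).symm)
    rw [mul_inv_eq_one, mul_inv_eq_iff_eq_mul] at h4
    exact h4
  have hxG : toBar F (g * h * g⁻¹ * h⁻¹) ∈ G := by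
    simp only [map_mul, map_inv]
    exact G.mul_mem (G.mul_mem (G.mul_mem hg.1 hh.1) (G.inv_mem hg.1)) (G.inv_mem hh.1)
  obtain ⟨i, j, hij, hroot⟩ := exists_mem_roots_of_isPositive hS hxG hx1 h1
  have h3 := h1 i j hij
  have h4 := h2 i j hij
  rw [dotProduct_smul] at h3 h4
  rcases dotProduct_eq_zero_or_of_mem_roots hR hΔ hD orth hlD hl hlD' hl' hroot with h5 | h5
  · rw [h5, smul_zero] at h3
    exact lt_irrefl _ h3
  · rw [h5, smul_zero] at h4
    exact lt_irrefl _ h4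

theorem commute_of_mem_leviPrime {ι : Type*} [Finite ι] (hS : S.points ≤ G)
    {R : RootPairing ι ℝ (Fin S.rank → ℝ) (Fin S.rank → ℝ)} [R.IsCrystallographic]
    (hR : IsRelativeRootSystem G S R) {Δ : Set (Fin S.rank → ℤ)} (hΔ : IsSimpleRoots G S Δ)
    {D : Set (Fin S.rank → ℤ)} (hD : D ⊆ Δ)
    (orth : ∀ α ∈ D, ∀ β ∈ Δ \ D, ∀ a b : ι, (R.root a = fun k => (α k : ℝ)) →
      (R.root b = fun k => (β k : ℝ)) → R.pairing a b = 0)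
    {g h : GL (Fin n) F} (hg : g ∈ leviPrime G S D) (hh : h ∈ leviPrime G S (Δ \ D)) :
    Commute g h := by
  have h1 : leviPrime G S D ≤ Subgroup.centralizer (leviPrime G S (Δ \ D) : Set (GL (Fin n) F)) := by
    rw [leviPrime, leviPrime, Subgroup.le_centralizer_iff, Subgroup.closure_le]
    intro y hy
    rw [SetLike.mem_coe, Subgroup.mem_centralizer_iff]
    intro x hx
    have : leviPrime G S D ≤ Subgroup.centralizer {y} := by
      rw [leviPrime, Subgroup.closure_le]
      intro x hx
      simp only [Set.mem_iUnion] at hx hy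
      obtain ⟨α, hα, hx⟩ := hx
      obtain ⟨β, hβ, hy⟩ := hy
      rw [SetLike.mem_coe, Subgroup.mem_centralizer_singleton_iff]
      exact commute_of_mem_rootGroup hS hR hΔ hD orth hα.1 hα.2 hβ.1 hβ.2 hx hy
    exact Subgroup.mem_centralizer_singleton_iff.1 (this hx)
  exact (Subgroup.mem_centralizer_iff.1 (h1 hg) h hh).symm

end AlgGrp

namespace ProP

/-! ### Quotients of data -/

variable {A O W W₁ Z : Type*} [Group A] [Group O] [Group W] [Group W₁] [Group Z]
  {S : Set A} {i : A →* W} {j : O →* W} {ι : Z →* W₁} {π : W₁ →* W}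

theorem IsDatum.eq_and_eq (h : IsDatum S i j ι π) {a a' : A} {u u' : O}
    (hw : i a * j u = i a' * j u') : a = a' ∧ u = u' := by
  obtain ⟨p, -, hp⟩ := h.semidirect (i a * j u)
  have h1 := hp (a, u) rfl
  have h2 := hp (a', u') hw
  exact Prod.ext_iff.1 (h1.trans h2.symm)

/-- `Ω` permutes the generators `S` of `W_aff`. -/
theorem IsDatum.exists_conj (h : IsDatum S i j ι π) (w : W) (a : A) :
    ∃ a', w * i a * w⁻¹ = i a' := by
  obtain ⟨M, cs, hcs⟩ := h.coxeter
  have hS : Subgroup.closure S = ⊤ := by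
    rw [← cs.subgroup_closure_range_simple]
    congr 1
    ext s
    constructor
    · exact fun hs => ⟨⟨s, hs⟩, hcs _⟩
    · rintro ⟨s, rfl⟩
      rw [hcs]
      exact s.2
  obtain ⟨⟨b, u⟩, rfl, -⟩ := h.semidirect w
  obtain ⟨a', ha'⟩ : ∃ a', j u * i a * (j u)⁻¹ = i a' := by
    have ha : a ∈ Subgroup.closure S := hS ▸ Subgroup.mem_top a
    induction ha using Subgroup.closure_induction with
    | mem s hs =>
      obtain ⟨s', -, h'⟩ := h.acts u s hs
      exact ⟨s', h'⟩
    | one => exact ⟨1, by simp⟩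
    | mul x y _ _ hx hy =>
      obtain ⟨x', hx⟩ := hx
      obtain ⟨y', hy⟩ := hy
      exact ⟨x' * y', by rw [map_mul, map_mul, ← hx, ← hy]; group⟩
    | inv x _ hx =>
      obtain ⟨x', hx⟩ := hx
      exact ⟨x'⁻¹, by rw [map_inv, map_inv, ← hx]; group⟩
  refine ⟨b * a' * b⁻¹, ?_⟩
  rw [map_mul, map_mul, map_inv, ← ha']
  group

theorem IsDatum.conj_mem_reflOne (h : IsDatum S i j ι π) (w : W₁) {s : W₁}
    (hs : s ∈ reflOne S i π) : w * s * w⁻¹ ∈ reflOne S i π := by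
  obtain ⟨a, s₀, hs₀, h1⟩ := hs
  obtain ⟨⟨b, u⟩, h2, -⟩ := h.semidirect (π w)
  obtain ⟨s₁, hs₁, h3⟩ := h.acts u s₀ hs₀
  obtain ⟨a', h4⟩ := h.exists_conj (j u) a
  refine ⟨b * a', s₁, hs₁, ?_⟩
  simp only [map_mul, map_inv, h1, ← h3, ← h4]
  simp only at h2
  rw [h2]
  group

theorem IsDatum.exists_conj_ι (h : IsDatum S i j ι π) (w : W₁) :
    ∃ φ : Z ≃* Z, ∀ z, ι (φ z) = w * ι z * w⁻¹ := by
  have key : ∀ (w : W₁) (z : Z), ∃ z', ι z' = w * ι z * w⁻¹ := by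
    intro w z
    have h1 : w * ι z * w⁻¹ ∈ ι.range := by
      have h2 : ι z ∈ π.ker := h.range_eq_ker ▸ ⟨z, rfl⟩
      rw [h.range_eq_ker, MonoidHom.mem_ker, map_mul, map_mul, MonoidHom.mem_ker.1 h2]
      simp
    exact h1
  choose f hf using key
  refine ⟨{ toFun := f w, invFun := f w⁻¹, left_inv := fun z => h.injective_ι ?_,
            right_inv := fun z => h.injective_ι ?_,
            map_mul' := fun x y => h.injective_ι ?_ }, fun z => hf w z⟩
  · rw [hf, hf]; group
  · rw [hf, hf]; group
  · rw [hf, map_mul, map_mul, hf, hf]; group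

theorem length_mul_right (w : W) (u : O) : length S i j (w * j u) = length S i j w := by
  unfold length
  congr 1
  ext l
  constructor
  · rintro ⟨L, hL, hl, v, hv⟩
    refine ⟨L, hL, hl, v * u⁻¹, ?_⟩
    rw [map_mul, ← mul_assoc, ← hv, map_inv]
    group
  · rintro ⟨L, hL, hl, v, rfl⟩
    exact ⟨L, hL, hl, v * u, by rw [map_mul, mul_assoc]⟩

theorem length_j (u : O) : length S i j (j u) = 0 :=
  Nat.sInf_eq_zero.2 (Or.inl ⟨[], by simp, rfl, u, by simp⟩)

/-- `Ω` is commutative if `W` is the product of a set of commuting elements and `W_aff`. -/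
theorem IsDatum.commute_of_supplement (h : IsDatum S i j ι π) {L : Set W}
    (hL : ∀ w, ∃ l ∈ L, ∃ a, w = l * i a) (hcomm : ∀ l ∈ L, ∀ l' ∈ L, l * l' = l' * l) (u v : O) :
    u * v = v * u := by
  have : i.range.Normal := ⟨by
    rintro _ ⟨a, rfl⟩ w
    obtain ⟨a', h'⟩ := h.exists_conj w a
    exact ⟨a', h'.symm⟩⟩
  have hmk : ∀ a, (QuotientGroup.mk (i a) : W ⧸ i.range) = 1 := fun a =>
    (QuotientGroup.eq_one_iff _).2 ⟨a, rfl⟩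
  obtain ⟨l, hl, a, hu⟩ := hL (j u)
  obtain ⟨l', hl', a', hv⟩ := hL (j v)
  -- `W ⧸ W_aff` is the image of the commuting set `L`, and `Ω` embeds in it.
  have h1 : (QuotientGroup.mk (j (v * u)) : W ⧸ i.range) = QuotientGroup.mk (j (u * v)) := by
    rw [map_mul, map_mul, hu, hv]
    simp only [QuotientGroup.mk_mul, hmk, mul_one]
    rw [← QuotientGroup.mk_mul, ← QuotientGroup.mk_mul, hcomm l hl l' hl']
  obtain ⟨b, hb⟩ := QuotientGroup.eq.1 h1.symm
  have h2 : i b * j 1 = i 1 * j ((u * v)⁻¹ * (v * u)) := by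
    rw [map_one, map_one, mul_one, one_mul, map_mul, map_inv, hb]
  have h3 := (h.eq_and_eq h2).2
  exact inv_mul_eq_one.1 h3.symm

section Quotient

variable (K : Subgroup W) (K₁ : Subgroup W₁) (Kz : Subgroup Z) [K.Normal] [K₁.Normal] [Kz.Normal]

theorem IsDatum.eq_one_of_mem (h : IsDatum S i j ι π) {K : Subgroup W} (hK : K ≤ j.range) {a : A}
    (ha : i a ∈ K) : a = 1 := by
  obtain ⟨u, hu⟩ := hK ha
  have : i a * j 1 = i 1 * j u := by rw [map_one, map_one, mul_one, one_mul, hu]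
  exact (h.eq_and_eq this).1

/-- `W_aff` embeds in the quotient of `W` by a subgroup of `Ω`. -/
theorem IsDatum.eq_of_mk_eq (h : IsDatum S i j ι π) {K : Subgroup W} [K.Normal]
    (hK : K ≤ j.range) {a b : A}
    (hab : (QuotientGroup.mk (i a) : W ⧸ K) = QuotientGroup.mk (i b)) : a = b := by
  have h1 := QuotientGroup.eq.1 hab
  rw [← map_inv, ← map_mul] at h1
  exact inv_mul_eq_one.1 (h.eq_one_of_mem hK h1)

/-- As `K ≤ Ω` meets `W_aff` trivially, the embedding of `W_aff` and the semidirect decomposition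
survive. Surjectivity of `K₁ → K` gives exactness in the middle, and `Kz = K₁ ∩ Z_κ` gives it on the
left. -/
theorem IsDatum.quotient (h : IsDatum S i j ι π) (hK : K ≤ j.range) (hmap : K₁.map π = K)
    (hι : Kz = K₁.comap ι) (hπ : K₁ ≤ K.comap π) (hle : Kz ≤ K₁.comap ι) :
    IsDatum S ((QuotientGroup.mk' K).comp i) (QuotientGroup.map (K.comap j) K j le_rfl)
      (QuotientGroup.map Kz K₁ ι hle) (QuotientGroup.map K₁ K π hπ) where
  coxeter := h.coxeter
  injective_i a b hab := h.eq_of_mk_eq hK hab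
  injective_j := by
    intro u v huv
    induction u using QuotientGroup.induction_on with | _ u
    induction v using QuotientGroup.induction_on with | _ v
    have h1 := QuotientGroup.eq.1 huv
    rw [← map_inv, ← map_mul] at h1
    exact QuotientGroup.eq.2 h1
  acts u s hs := by
    induction u using QuotientGroup.induction_on with | _ u
    obtain ⟨s', hs', h1⟩ := h.acts u s hs
    exact ⟨s', hs', congrArg (QuotientGroup.mk' K) h1⟩
  semidirect w := by
    induction w using QuotientGroup.induction_on with | _ w
    obtain ⟨⟨a, u⟩, rfl, -⟩ := h.semidirect w
    refine ⟨(a, QuotientGroup.mk u), rfl, ?_⟩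
    rintro ⟨a', u'⟩ h1
    induction u' using QuotientGroup.induction_on with | _ u'
    have h2 := (QuotientGroup.eq (s := K) (a := i a * j u) (b := i a' * j u')).1 h1
    obtain ⟨o, ho⟩ := hK h2
    have h3 : i a * j (u * o) = i a' * j u' := by
      rw [map_mul, ho]; group
    obtain ⟨rfl, rfl⟩ := h.eq_and_eq h3
    refine Prod.ext rfl ?_
    refine QuotientGroup.eq.2 ?_
    have h4 : j o ∈ K := ho ▸ h2
    have h5 : (u * o)⁻¹ * u = o⁻¹ := by group
    rw [h5]
    exact inv_mem (show o ∈ K.comap j from h4)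
  finite := have := h.finite; inferInstance
  comm x y := by
    induction x using QuotientGroup.induction_on with | _ x
    induction y using QuotientGroup.induction_on with | _ y
    exact congrArg (QuotientGroup.mk' Kz) (h.comm x y)
  injective_ι := by
    intro u v huv
    induction u using QuotientGroup.induction_on with | _ u
    induction v using QuotientGroup.induction_on with | _ v
    have h1 := QuotientGroup.eq.1 huv
    rw [← map_inv, ← map_mul] at h1
    refine QuotientGroup.eq.2 ?_
    rw [hι]
    exact h1
  range_eq_ker := by
    ext w
    induction w using QuotientGroup.induction_on with | _ w
    constructor
    · rintro ⟨z, hz⟩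
      induction z using QuotientGroup.induction_on with | _ z
      rw [← hz, MonoidHom.mem_ker]
      have h2 : ι z ∈ π.ker := h.range_eq_ker ▸ ⟨z, rfl⟩
      exact congrArg (QuotientGroup.mk' K) (MonoidHom.mem_ker.1 h2)
    · intro hw
      have h1 : π w ∈ K := (QuotientGroup.eq_one_iff _).1 (MonoidHom.mem_ker.1 hw)
      rw [← hmap] at h1
      obtain ⟨k, hk, hkw⟩ := h1
      have h2 : w * k⁻¹ ∈ ι.range := by
        rw [h.range_eq_ker, MonoidHom.mem_ker, map_mul, map_inv, hkw, mul_inv_cancel]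
      obtain ⟨z, hz⟩ := h2
      refine ⟨QuotientGroup.mk z, ?_⟩
      have h3 : (QuotientGroup.mk (ι z) : W₁ ⧸ K₁) = QuotientGroup.mk w := by
        rw [hz]
        refine QuotientGroup.eq.2 ?_
        have : (w * k⁻¹)⁻¹ * w = k := by group
        rwa [this]
      exact h3
  surjective_π w := by
    induction w using QuotientGroup.induction_on with | _ w
    obtain ⟨v, rfl⟩ := h.surjective_π w
    exact ⟨QuotientGroup.mk v, rfl⟩

theorem length_quotient (hK : K ≤ j.range) (w : W) :
    length S ((QuotientGroup.mk' K).comp i) (QuotientGroup.map (K.comap j) K j le_rfl)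
      (QuotientGroup.mk w) = length S i j w := by
  unfold length
  congr 1
  ext l
  constructor
  · rintro ⟨L, hL, hl, u, hu⟩
    induction u using QuotientGroup.induction_on with | _ u
    have h1 := (QuotientGroup.eq (s := K) (a := i L.prod * j u) (b := w)).1 hu.symm
    obtain ⟨o, ho⟩ := hK h1
    refine ⟨L, hL, hl, u * o, ?_⟩
    rw [map_mul, ho]
    group
  · rintro ⟨L, hL, hl, u, rfl⟩
    exact ⟨L, hL, hl, QuotientGroup.mk u, rfl⟩

variable {K K₁ Kz}

/-- An arbitrary lift lies over a reflection only up to `K`; an element of `K₁` above the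
discrepancy corrects it. -/
theorem exists_lift_reflOne (hmap : K₁.map π = K)
    (hπ : K₁ ≤ K.comap π) {s : W₁ ⧸ K₁}
    (hs : s ∈ reflOne S ((QuotientGroup.mk' K).comp i) (QuotientGroup.map K₁ K π hπ)) :
    ∃ s₀ ∈ reflOne S i π, s = QuotientGroup.mk s₀ := by
  obtain ⟨a, t, ht, h1⟩ := hs
  induction s using QuotientGroup.induction_on with | _ s
  have h2 := (QuotientGroup.eq (s := K) (a := i (a * t * a⁻¹)) (b := π s)).1 h1.symm
  rw [← hmap] at h2
  obtain ⟨k, hk, hks⟩ := h2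
  refine ⟨s * k⁻¹, ⟨a, t, ht, ?_⟩, ?_⟩
  · rw [map_mul π, map_inv π, hks]
    group
  · refine QuotientGroup.eq.2 ?_
    have : s⁻¹ * (s * k⁻¹) = k⁻¹ := by group
    rw [this]
    exact inv_mem hk

variable {C : Type*} [CommRing C] {q : S → C} {c : reflOne S i π → MonoidAlgebra C Z}

/-- Both lifts lie over the same reflection, because `W_aff` embeds in `W ⧸ K`. They differ by some
`z ∈ Kz`, so `c` changes by the factor `z`, whose image is `1`. -/
theorem IsParameter.mapDomain_eq (hc : IsParameter S i ι π q c) (h : IsDatum S i j ι π)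
    (hK : K ≤ j.range) (hπ : K₁ ≤ K.comap π) (hι : Kz = K₁.comap ι) (s t : reflOne S i π)
    (hst : (QuotientGroup.mk s.val : W₁ ⧸ K₁) = QuotientGroup.mk t.val) :
    MonoidAlgebra.mapDomain (QuotientGroup.mk : Z → Z ⧸ Kz) (c s) =
      MonoidAlgebra.mapDomain QuotientGroup.mk (c t) := by
  obtain ⟨a, s₀, hs₀, h1⟩ := s.2
  obtain ⟨b, t₀, ht₀, h2⟩ := t.2
  have h3 : a * s₀ * a⁻¹ = b * t₀ * b⁻¹ := by
    apply h.eq_of_mk_eq hK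
    have := congrArg (QuotientGroup.map K₁ K π hπ) hst
    rw [← h1, ← h2]
    exact this
  have h4 : s.val * t.val⁻¹ ∈ ι.range := by
    rw [h.range_eq_ker, MonoidHom.mem_ker, map_mul, map_inv, h1, h2, h3, mul_inv_cancel]
  obtain ⟨z, hz⟩ := h4
  have hzK : z ∈ Kz := by
    rw [hι, Subgroup.mem_comap, hz]
    have h5 : (QuotientGroup.mk (s.val * t.val⁻¹) : W₁ ⧸ K₁) = 1 := by
      rw [QuotientGroup.mk_mul, QuotientGroup.mk_inv, hst, mul_inv_cancel]
    exact (QuotientGroup.eq_one_iff _).1 h5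
  rw [hc.c_mul z t s (by rw [hz]; group)]
  have h6 := MonoidAlgebra.mapDomain_mul (QuotientGroup.mk' Kz) (MonoidAlgebra.single z 1) (c t)
  rw [MonoidAlgebra.mapDomain_single, show QuotientGroup.mk' Kz z = 1 from
    (QuotientGroup.eq_one_iff z).2 hzK, ← MonoidAlgebra.one_def, one_mul] at h6
  exact h6

theorem IsParameter.c_conj_eq_mapDomain (hc : IsParameter S i ι π q c) {w : W₁} {φ : Z ≃* Z}
    (hφ : ∀ z, ι (φ z) = w * ι z * w⁻¹) (s s' : reflOne S i π) (hs : s'.val = w * s * w⁻¹) :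
    c s' = MonoidAlgebra.mapDomain φ (c s) := by
  ext z
  obtain ⟨z, rfl⟩ := φ.surjective z
  rw [hc.c_conj w s s' hs z (φ z) (hφ z), MonoidAlgebra.coeff_mapDomain,
    Finsupp.mapDomain_apply φ.injective]

theorem IsParameter.exists_quotient (hc : IsParameter S i ι π q c) (h : IsDatum S i j ι π)
    (hK : K ≤ j.range) (hmap : K₁.map π = K) (hπ : K₁ ≤ K.comap π) (hι : Kz = K₁.comap ι)
    (hle : Kz ≤ K₁.comap ι) :
    ∃ c' : reflOne S ((QuotientGroup.mk' K).comp i) (QuotientGroup.map K₁ K π hπ) →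
        MonoidAlgebra C (Z ⧸ Kz),
      (∀ (s : reflOne S i π)
        (s' : reflOne S ((QuotientGroup.mk' K).comp i) (QuotientGroup.map K₁ K π hπ)),
        s'.val = QuotientGroup.mk s.val →
          c' s' = MonoidAlgebra.mapDomain QuotientGroup.mk (c s)) ∧
      IsParameter S ((QuotientGroup.mk' K).comp i) (QuotientGroup.map Kz K₁ ι hle)
        (QuotientGroup.map K₁ K π hπ) q c' := by
  choose f hf hf' using fun s' : reflOne S ((QuotientGroup.mk' K).comp i)
    (QuotientGroup.map K₁ K π hπ) => exists_lift_reflOne hmap hπ s'.2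
  let c' : reflOne S ((QuotientGroup.mk' K).comp i) (QuotientGroup.map K₁ K π hπ) →
      MonoidAlgebra C (Z ⧸ Kz) := fun s' =>
    MonoidAlgebra.mapDomain QuotientGroup.mk (c ⟨f s', hf s'⟩)
  have hc' : ∀ (s : reflOne S i π)
      (s' : reflOne S ((QuotientGroup.mk' K).comp i) (QuotientGroup.map K₁ K π hπ)),
      s'.val = QuotientGroup.mk s.val →
        c' s' = MonoidAlgebra.mapDomain QuotientGroup.mk (c s) := fun s s' hs =>
    hc.mapDomain_eq h hK hπ hι _ _ ((hf' s').symm.trans hs)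
  refine ⟨c', hc', ?_, ?_, ?_⟩
  · intro w s s' hw
    induction w using QuotientGroup.induction_on with | _ w
    obtain ⟨⟨b, u⟩, rfl, -⟩ := h.semidirect w
    -- The conjugate of `s` and `s'` both lie in `W_aff`, so equality modulo `K` is equality.
    obtain ⟨a, ha⟩ := h.exists_conj (i b * j u) s
    refine hc.q_conj (i b * j u) s s' ?_
    rw [ha]
    congr 1
    apply h.eq_of_mk_eq hK
    rw [← ha]
    exact hw
  · intro w s s' hw z z' hz
    induction w using QuotientGroup.induction_on with | _ w
    induction z using QuotientGroup.induction_on with | _ z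
    obtain ⟨φ, hφ⟩ := h.exists_conj_ι w
    let s₁ : reflOne S i π := ⟨w * f s * w⁻¹, h.conj_mem_reflOne w (hf s)⟩
    have h1 : s'.val = QuotientGroup.mk s₁.val := by
      rw [hw, hf' s]
      rfl
    have hφK : ∀ z, φ z ∈ Kz ↔ z ∈ Kz := by
      intro z
      rw [hι, Subgroup.mem_comap, Subgroup.mem_comap, hφ]
      constructor
      · intro h2
        have h3 := Subgroup.Normal.conj_mem inferInstance _ h2 w⁻¹
        have h4 : w⁻¹ * (w * ι z * w⁻¹) * w⁻¹⁻¹ = ι z := by group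
        rwa [h4] at h3
      · intro h2
        exact Subgroup.Normal.conj_mem inferInstance _ h2 w
    -- Conjugation by `w` preserves `Kz`; the induced injective map transports the coefficients of
    -- `c'`.
    let ψ : Z ⧸ Kz → Z ⧸ Kz := QuotientGroup.map Kz Kz φ.toMonoidHom
      (fun z hz => (hφK z).2 hz)
    have hψ : Function.Injective ψ := by
      intro x y hxy
      induction x using QuotientGroup.induction_on with | _ x
      induction y using QuotientGroup.induction_on with | _ y
      have h2 := (QuotientGroup.eq (s := Kz) (a := φ x) (b := φ y)).1 hxy
      rw [← map_inv, ← map_mul, hφK] at h2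
      exact QuotientGroup.eq.2 h2
    have hz' : z' = ψ (QuotientGroup.mk z) := by
      induction z' using QuotientGroup.induction_on with | _ z'
      refine QuotientGroup.eq.2 ?_
      have h2 := (QuotientGroup.eq (s := K₁) (a := ι z') (b := w * ι z * w⁻¹)).1 hz
      rw [hι, Subgroup.mem_comap, map_mul, map_inv]
      exact (hφ z).symm ▸ h2
    have h5 : (c' s').coeff = Finsupp.mapDomain ψ (c' s).coeff := by
      rw [hc' s₁ s' h1, hc.c_conj_eq_mapDomain hφ ⟨f s, hf s⟩ s₁ rfl]
      change Finsupp.mapDomain _ (Finsupp.mapDomain _ _) =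
        Finsupp.mapDomain _ (Finsupp.mapDomain _ _)
      rw [← Finsupp.mapDomain_comp, ← Finsupp.mapDomain_comp]
      rfl
    rw [h5, hz', Finsupp.mapDomain_apply hψ]
  · intro z s s' hs
    induction z using QuotientGroup.induction_on with | _ z
    have hz : π (ι z) = 1 := by
      have h2 : ι z ∈ π.ker := h.range_eq_ker ▸ ⟨z, rfl⟩
      exact MonoidHom.mem_ker.1 h2
    let s₁ : reflOne S i π := ⟨ι z * f s, by
      obtain ⟨a, t, ht, h1⟩ := hf s
      exact ⟨a, t, ht, by rw [map_mul, hz, one_mul, h1]⟩⟩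
    have h1 : s'.val = QuotientGroup.mk s₁.val := by
      rw [hs, hf' s]
      rfl
    rw [hc' s₁ s' h1, hc.c_mul z ⟨f s, hf s⟩ s₁ rfl]
    have h6 := MonoidAlgebra.mapDomain_mul (QuotientGroup.mk' Kz) (MonoidAlgebra.single z 1)
      (c ⟨f s, hf s⟩)
    rw [MonoidAlgebra.mapDomain_single] at h6
    exact h6

/-! ### Quotients of Hecke algebras -/

variable {H : Type*} [Ring H] [Algebra C H] {T : Module.Basis W₁ C H}

variable (K₁ T) in
/-- The ideal of the Hecke algebra generated by the `T_k - 1`. -/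
def quotientIdeal : TwoSidedIdeal H := TwoSidedIdeal.span {x | ∃ w ∈ K₁, x = T w - 1}

theorem IsHeckeAlgebra.mul_right (hT : IsHeckeAlgebra S i j ι π q c T) (hK : K ≤ j.range)
    (hπ : K₁ ≤ K.comap π) {k : W₁} (hk : k ∈ K₁) (w : W₁) : T (w * k) = T w * T k := by
  apply hT.braid
  obtain ⟨u, hu⟩ := hK (hπ hk)
  rw [map_mul, ← hu, length_mul_right, length_j, add_zero]

/-- Normality rewrites `k * w` as `w * k'` with `k' ∈ K₁`, so its length is that of `w`. -/
theorem IsHeckeAlgebra.mul_left (hT : IsHeckeAlgebra S i j ι π q c T) (hK : K ≤ j.range)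
    (hπ : K₁ ≤ K.comap π) {k : W₁} (hk : k ∈ K₁) (w : W₁) : T (k * w) = T k * T w := by
  apply hT.braid
  have h1 : w⁻¹ * k * w ∈ K₁ := by
    simpa using Subgroup.Normal.conj_mem inferInstance _ hk w⁻¹
  obtain ⟨u, hu⟩ := hK (hπ hk)
  obtain ⟨v, hv⟩ := hK (hπ h1)
  have h2 : k * w = w * (w⁻¹ * k * w) := by group
  rw [h2, map_mul, ← hv, length_mul_right, ← hu, length_j, zero_add]

variable (K₁ T) in
/-- The span of the `T_{wk} - T_w`. -/
def quotientSpan : Submodule C H := Submodule.span C {x | ∃ w, ∃ k ∈ K₁, x = T (w * k) - T w}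

theorem IsHeckeAlgebra.mul_mem_quotientSpan_left (hT : IsHeckeAlgebra S i j ι π q c T)
    (hK : K ≤ j.range) (hπ : K₁ ≤ K.comap π) (x : H) {y : H} (hy : y ∈ quotientSpan K₁ T) :
    x * y ∈ quotientSpan K₁ T := by
  have key : ∀ x : H, ∀ k ∈ K₁, x * (T k - 1) ∈ quotientSpan K₁ T := by
    intro x k hk
    have hx : x ∈ Submodule.span C (Set.range T) := by rw [T.span_eq]; trivial
    induction hx using Submodule.span_induction with
    | mem x hx =>
      obtain ⟨w, rfl⟩ := hx
      refine Submodule.subset_span ⟨w, k, hk, ?_⟩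
      rw [hT.mul_right hK hπ hk, mul_sub, mul_one]
    | zero => rw [zero_mul]; exact Submodule.zero_mem _
    | add x y _ _ hx hy => rw [add_mul]; exact Submodule.add_mem _ hx hy
    | smul a x _ hx => rw [smul_mul_assoc]; exact Submodule.smul_mem _ a hx
  unfold quotientSpan at hy
  induction hy using Submodule.span_induction with
  | mem y hy =>
    obtain ⟨w, k, hk, rfl⟩ := hy
    have : x * (T (w * k) - T w) = (x * T w) * (T k - 1) := by
      rw [hT.mul_right hK hπ hk]; noncomm_ring
    rw [this]
    exact key _ k hk
  | zero => rw [mul_zero]; exact Submodule.zero_mem _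
  | add y z _ _ hy hz => rw [mul_add]; exact Submodule.add_mem _ hy hz
  | smul a y _ hy => rw [mul_smul_comm]; exact Submodule.smul_mem _ a hy

/-- Moving `T k` to the right of `T w` replaces `k` by `w⁻¹ * k * w`, which is still in `K₁`. -/
theorem IsHeckeAlgebra.mul_mem_quotientSpan_right (hT : IsHeckeAlgebra S i j ι π q c T)
    (hK : K ≤ j.range) (hπ : K₁ ≤ K.comap π) {x : H} (hx : x ∈ quotientSpan K₁ T) (y : H) :
    x * y ∈ quotientSpan K₁ T := by
  have key : ∀ y : H, ∀ k ∈ K₁, (T k - 1) * y ∈ quotientSpan K₁ T := by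
    intro y k hk
    have hy : y ∈ Submodule.span C (Set.range T) := by rw [T.span_eq]; trivial
    induction hy using Submodule.span_induction with
    | mem y hy =>
      obtain ⟨w, rfl⟩ := hy
      refine Submodule.subset_span ⟨w, w⁻¹ * k * w, ?_, ?_⟩
      · simpa using Subgroup.Normal.conj_mem inferInstance _ hk w⁻¹
      · rw [sub_mul, one_mul, ← hT.mul_left hK hπ hk]
        congr 2
        group
    | zero => rw [mul_zero]; exact Submodule.zero_mem _
    | add x y _ _ hx hy => rw [mul_add]; exact Submodule.add_mem _ hx hy
    | smul a x _ hx => rw [mul_smul_comm]; exact Submodule.smul_mem _ a hx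
  unfold quotientSpan at hx
  induction hx using Submodule.span_induction with
  | mem x hx =>
    obtain ⟨w, k, hk, rfl⟩ := hx
    have : (T (w * k) - T w) * y = T w * ((T k - 1) * y) := by
      rw [hT.mul_right hK hπ hk]; noncomm_ring
    rw [this]
    exact hT.mul_mem_quotientSpan_left hK hπ _ (key y k hk)
  | zero => rw [zero_mul]; exact Submodule.zero_mem _
  | add y z _ _ hy hz => rw [add_mul]; exact Submodule.add_mem _ hy hz
  | smul a y _ hy => rw [smul_mul_assoc]; exact Submodule.smul_mem _ a hy

/-- The braid relation makes `T 1` a right unit on the basis. -/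
theorem IsHeckeAlgebra.T_one (hT : IsHeckeAlgebra S i j ι π q c T) : T 1 = 1 := by
  have h1 : ∀ x : H, x * T 1 = x := by
    intro x
    have hx : x ∈ Submodule.span C (Set.range T) := by rw [T.span_eq]; trivial
    induction hx using Submodule.span_induction with
    | mem x hx =>
      obtain ⟨w, rfl⟩ := hx
      rw [← hT.braid, mul_one]
      rw [mul_one, map_one π, ← map_one j, length_j, add_zero]
    | zero => rw [zero_mul]
    | add x y _ _ hx hy => rw [add_mul, hx, hy]
    | smul a x _ hx => rw [smul_mul_assoc, hx]
  rw [← one_mul (T 1), h1]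

/-- The span is a two-sided ideal and contains the generators `T k - 1 = T (1 * k) - T 1`. -/
theorem IsHeckeAlgebra.mem_quotientSpan_of_mem (hT : IsHeckeAlgebra S i j ι π q c T)
    (hK : K ≤ j.range) (hπ : K₁ ≤ K.comap π) {x : H} (hx : x ∈ quotientIdeal K₁ T) :
    x ∈ quotientSpan K₁ T := by
  let J : TwoSidedIdeal H := TwoSidedIdeal.mk' (quotientSpan K₁ T) (Submodule.zero_mem _)
    (fun hx hy => Submodule.add_mem _ hx hy) (fun hx => Submodule.neg_mem _ hx)
    (fun hy => hT.mul_mem_quotientSpan_left hK hπ _ hy)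
    (fun hx => hT.mul_mem_quotientSpan_right hK hπ hx _)
  have h1 : quotientIdeal K₁ T ≤ J := by
    rw [quotientIdeal, TwoSidedIdeal.span_le]
    rintro x ⟨k, hk, rfl⟩
    rw [SetLike.mem_coe, TwoSidedIdeal.mem_mk']
    refine Submodule.subset_span ⟨1, k, hk, ?_⟩
    rw [one_mul, hT.T_one]
  have h2 := h1 hx
  rwa [TwoSidedIdeal.mem_mk'] at h2

theorem mapDomain_repr_eq_zero {x : H} (hx : x ∈ quotientSpan K₁ T) :
    Finsupp.mapDomain (QuotientGroup.mk : W₁ → W₁ ⧸ K₁) (T.repr x) = 0 := by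
  unfold quotientSpan at hx
  induction hx using Submodule.span_induction with
  | mem x hx =>
    obtain ⟨w, k, hk, rfl⟩ := hx
    rw [map_sub, T.repr_self, T.repr_self, sub_eq_add_neg, Finsupp.mapDomain_add,
      ← Finsupp.single_neg, Finsupp.mapDomain_single, Finsupp.mapDomain_single,
      QuotientGroup.mk_mul_of_mem w hk, ← Finsupp.single_add, add_neg_cancel, Finsupp.single_zero]
  | zero => simp
  | add x y _ _ hx hy => rw [map_add, Finsupp.mapDomain_add, hx, hy, add_zero]
  | smul a x _ hx => rw [map_smul, Finsupp.mapDomain_smul, hx, smul_zero]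

theorem IsHeckeAlgebra.mk_T_eq (hT : IsHeckeAlgebra S i j ι π q c T) (hK : K ≤ j.range)
    (hπ : K₁ ≤ K.comap π) {v w : W₁}
    (h : (QuotientGroup.mk v : W₁ ⧸ K₁) = QuotientGroup.mk w) :
    (quotientIdeal K₁ T).ringCon.mk' (T v) = (quotientIdeal K₁ T).ringCon.mk' (T w) := by
  have hk := QuotientGroup.eq.1 h
  have h1 : T w = T v * T (v⁻¹ * w) := by
    rw [← hT.mul_right hK hπ hk, mul_inv_cancel_left]
  have h2 : (quotientIdeal K₁ T).ringCon.mk' (T (v⁻¹ * w)) = 1 := by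
    rw [← map_one (quotientIdeal K₁ T).ringCon.mk']
    refine (RingCon.eq _).2 ?_
    rw [TwoSidedIdeal.rel_iff]
    exact TwoSidedIdeal.subset_span ⟨_, hk, rfl⟩
  rw [h1, map_mul, h2, mul_one]

theorem IsHeckeAlgebra.exists_basis_quotient (hT : IsHeckeAlgebra S i j ι π q c T)
    (hK : K ≤ j.range) (hπ : K₁ ≤ K.comap π) :
    ∃ T' : Module.Basis (W₁ ⧸ K₁) C (quotientIdeal K₁ T).ringCon.Quotient,
      ∀ w, T' (QuotientGroup.mk w) = (quotientIdeal K₁ T).ringCon.mk' (T w) := by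
  let I := (quotientIdeal K₁ T).ringCon
  let p : H →ₗ[C] I.Quotient := (RingCon.mkₐ (α := C) I).toLinearMap
  have hp : ∀ x, p x = I.mk' x := fun _ => rfl
  let v : W₁ ⧸ K₁ → H := fun x => T x.out
  have hv : ∀ w, p (v (QuotientGroup.mk w)) = p (T w) := fun w =>
    hT.mk_T_eq hK hπ (Quotient.out_eq _)
  have hli : LinearIndependent C (fun x => p (v x)) := by
    rw [linearIndependent_iff]
    intro l hl
    have h1 : p (Finsupp.linearCombination C v l) = 0 := by
      rw [← hl, Finsupp.apply_linearCombination]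
      rfl
    have h2 : Finsupp.linearCombination C v l ∈ quotientIdeal K₁ T := by
      rw [hp, ← map_zero I.mk'] at h1
      have h3 := (RingCon.eq _).1 h1
      rwa [TwoSidedIdeal.rel_iff, sub_zero] at h3
    have h4 := mapDomain_repr_eq_zero (hT.mem_quotientSpan_of_mem hK hπ h2)
    rw [← h4]
    -- Summing coordinates over cosets is a left inverse to combining coset representatives, and it
    -- kills the ideal.
    have h5 : (Finsupp.lmapDomain C C (QuotientGroup.mk : W₁ → W₁ ⧸ K₁)) ∘ₗ
        T.repr.toLinearMap ∘ₗ Finsupp.linearCombination C v = LinearMap.id := by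
      ext x : 2
      have hx : (QuotientGroup.mk x.out : W₁ ⧸ K₁) = x := Quotient.out_eq _
      simp only [LinearMap.comp_apply, Finsupp.lsingle_apply, Finsupp.linearCombination_single,
        one_smul, v, LinearEquiv.coe_coe, T.repr_self, Finsupp.lmapDomain_apply,
        Finsupp.mapDomain_single, hx, LinearMap.id_apply]
    exact (LinearMap.congr_fun h5 l).symm
  have hsp : ⊤ ≤ Submodule.span C (Set.range fun x => p (v x)) := by
    rintro x -
    obtain ⟨y, rfl⟩ := RingCon.mkₐ_surjective (α := C) I x
    have hy : y ∈ Submodule.span C (Set.range T) := by rw [T.span_eq]; trivial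
    change p y ∈ _
    induction hy using Submodule.span_induction with
    | mem y hy =>
      obtain ⟨w, rfl⟩ := hy
      rw [← hv]
      exact Submodule.subset_span ⟨_, rfl⟩
    | zero => rw [map_zero]; exact Submodule.zero_mem _
    | add x y _ _ hx hy => rw [map_add]; exact Submodule.add_mem _ hx hy
    | smul a x _ hx => rw [map_smul]; exact Submodule.smul_mem _ a hx
  refine ⟨Module.Basis.mk hli hsp, fun w => ?_⟩
  rw [Module.Basis.mk_apply]
  exact hv w

theorem IsHeckeAlgebra.quotient (hT : IsHeckeAlgebra S i j ι π q c T) (h : IsDatum S i j ι π)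
    (hK : K ≤ j.range) (hmap : K₁.map π = K) (hπ : K₁ ≤ K.comap π) (hle : Kz ≤ K₁.comap ι)
    {c' : reflOne S ((QuotientGroup.mk' K).comp i) (QuotientGroup.map K₁ K π hπ) →
        MonoidAlgebra C (Z ⧸ Kz)}
    (hc' : ∀ (s : reflOne S i π)
        (s' : reflOne S ((QuotientGroup.mk' K).comp i) (QuotientGroup.map K₁ K π hπ)),
        s'.val = QuotientGroup.mk s.val →
          c' s' = MonoidAlgebra.mapDomain QuotientGroup.mk (c s))
    {T' : Module.Basis (W₁ ⧸ K₁) C (quotientIdeal K₁ T).ringCon.Quotient}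
    (hT' : ∀ w, T' (QuotientGroup.mk w) = (quotientIdeal K₁ T).ringCon.mk' (T w)) :
    IsHeckeAlgebra S ((QuotientGroup.mk' K).comp i) (QuotientGroup.map (K.comap j) K j le_rfl)
      (QuotientGroup.map Kz K₁ ι hle) (QuotientGroup.map K₁ K π hπ) q c' T' where
  quadratic s w' hs := by
    obtain ⟨w, hw, hww'⟩ := exists_lift_reflOne hmap hπ w'.2
    -- The lift lies over some reflection congruent to `s` modulo `K`, hence over `s` itself, and
    -- the quadratic relation applies to it.
    have h1 : π w = i s := by
      obtain ⟨a, t, ht, h2⟩ := hw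
      rw [h2]
      congr 1
      apply h.eq_of_mk_eq hK
      rw [hww'] at hs
      rw [← h2]
      exact hs
    let p := RingCon.mkₐ (α := C) (quotientIdeal K₁ T).ringCon
    have h2 := congrArg p (hT.quadratic s ⟨w, hw⟩ h1)
    have hT'' : ∀ w, p (T w) = T' (QuotientGroup.mk w) := fun w => (hT' w).symm
    rw [map_mul p, map_add p, map_mul p, map_smul p, map_finsuppSum p] at h2
    simp only [map_smul, hT''] at h2
    rw [hc' ⟨w, hw⟩ w' hww', MonoidAlgebra.coeff_mapDomain, Finsupp.sum_mapDomain_index, hww']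
    · exact h2
    · intro; rw [zero_smul]
    · intro _ _ _; rw [add_smul]
  braid v w hvw := by
    induction v using QuotientGroup.induction_on with | _ v
    induction w using QuotientGroup.induction_on with | _ w
    have h1 : length S i j (π (v * w)) = length S i j (π v) + length S i j (π w) := by
      rw [← length_quotient K hK, ← length_quotient K hK, ← length_quotient K hK]
      exact hvw
    rw [← QuotientGroup.mk_mul, hT', hT', hT', hT.braid v w h1, map_mul]

end Quotient

end ProP

namespace AlgGrp

/-! ### Standard Levi subgroups and their Iwahori-Weyl groups -/

variable {F : Type*} [Field F] {n : ℕ} {G : Subgroup (GL (Fin n) (AlgebraicClosure F))}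
  {S : SplitTorus F n}

/-- `z` commutes with the cocharacters of `S`, so conjugation by `z` carries the contraction along.
-/
theorem conj_mem_rootGroup {α : Fin S.rank → ℤ} {z g : GL (Fin n) F} (hz : z ∈ zPts G S)
    (hg : g ∈ rootGroup G S α) : z * g * z⁻¹ ∈ rootGroup G S α := by
  refine ⟨?_, fun l hl => ?_⟩
  · rw [map_mul, map_mul, map_inv]
    exact G.mul_mem (G.mul_mem hz.1 hg.1) (G.inv_mem hz.1)
  · obtain ⟨Q, h1, h2⟩ := hg.2 l hl
    set y := toBar F z with hy
    refine ⟨y.val.map Polynomial.C * Q * (y⁻¹).val.map Polynomial.C, fun t i j => ?_,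
      fun i j => ?_⟩
    · have hc : S.cochar l t * y = y * S.cochar l t :=
        Subgroup.mem_centralizer_iff.1 hz.2 _ ⟨_, rfl⟩
      have h3 : S.cochar l t * toBar F (z * g * z⁻¹) * (S.cochar l t)⁻¹ =
          y * (S.cochar l t * toBar F g * (S.cochar l t)⁻¹) * y⁻¹ := by
        rw [map_mul, map_mul, map_inv, ← hy]
        have h4 : (S.cochar l t)⁻¹ * y⁻¹ = y⁻¹ * (S.cochar l t)⁻¹ := by
          rw [← mul_inv_rev, ← mul_inv_rev, hc]
        calc _ = (S.cochar l t * y) * toBar F g * (y⁻¹ * (S.cochar l t)⁻¹) := by group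
          _ = _ := by rw [hc, ← h4]; group
      have h5 : (S.cochar l t * toBar F g * (S.cochar l t)⁻¹).val =
          Q.map (Polynomial.evalRingHom (t : AlgebraicClosure F)) := by
        ext i j; exact h1 t i j
      have h6 : ∀ M : Matrix (Fin n) (Fin n) (AlgebraicClosure F),
          (M.map Polynomial.C).map (Polynomial.evalRingHom (t : AlgebraicClosure F)) = M := by
        intro M; ext i j; simp
      have h7 : (y * (S.cochar l t * toBar F g * (S.cochar l t)⁻¹) * y⁻¹).val =
          (y.val.map Polynomial.C * Q * (y⁻¹).val.map Polynomial.C).map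
            (Polynomial.evalRingHom (t : AlgebraicClosure F)) := by
        rw [Matrix.map_mul, Matrix.map_mul, h6, h6, ← h5, Units.val_mul, Units.val_mul]
      rw [h3]
      exact congrFun (congrFun h7 i) j
    · have h5 : Q.map (Polynomial.evalRingHom (0 : AlgebraicClosure F)) = 1 := by
        ext i j; exact h2 i j
      have h6 : ∀ M : Matrix (Fin n) (Fin n) (AlgebraicClosure F),
          (M.map Polynomial.C).map (Polynomial.evalRingHom (0 : AlgebraicClosure F)) = M := by
        intro M; ext i j; simp
      have h7 : (y.val.map Polynomial.C * Q * (y⁻¹).val.map Polynomial.C).map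
          (Polynomial.evalRingHom (0 : AlgebraicClosure F)) = 1 := by
        rw [Matrix.map_mul, Matrix.map_mul, h6, h6, h5, mul_one, ← Units.val_mul, mul_inv_cancel,
          Units.val_one]
      exact congrFun (congrFun h7 i) j

theorem conj_mem_leviPrime {D : Set (Fin S.rank → ℤ)} {z g : GL (Fin n) F} (hz : z ∈ zPts G S)
    (hg : g ∈ leviPrime G S D) : z * g * z⁻¹ ∈ leviPrime G S D := by
  unfold leviPrime at hg ⊢
  induction hg using Subgroup.closure_induction with
  | mem x hx =>
    apply Subgroup.subset_closure
    simp only [Set.mem_iUnion] at hx ⊢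
    obtain ⟨α, hα, hx⟩ := hx
    exact ⟨α, hα, conj_mem_rootGroup hz hx⟩
  | one => simp
  | mul x y _ _ hx hy =>
    have h := Subgroup.mul_mem _ hx hy
    have h' : z * x * z⁻¹ * (z * y * z⁻¹) = z * (x * y) * z⁻¹ := by group
    rwa [h'] at h
  | inv x _ hx =>
    have h := Subgroup.inv_mem _ hx
    have h' : (z * x * z⁻¹)⁻¹ = z * x⁻¹ * z⁻¹ := by group
    rwa [h'] at h

/-- `Z(F)` normalizes `M'`, so the join is a product. -/
theorem exists_mul_of_mem_leviPts {D : Set (Fin S.rank → ℤ)} {g : GL (Fin n) F}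
    (hg : g ∈ leviPts G S D) : ∃ z ∈ zPts G S, ∃ m ∈ leviPrime G S D, g = z * m := by
  unfold leviPts at hg
  rw [Subgroup.sup_eq_closure] at hg
  induction hg using Subgroup.closure_induction with
  | mem x hx =>
    rcases hx with hx | hx
    · exact ⟨x, hx, 1, Subgroup.one_mem _, by simp⟩
    · exact ⟨1, Subgroup.one_mem _, x, hx, by simp⟩
  | one => exact ⟨1, Subgroup.one_mem _, 1, Subgroup.one_mem _, by simp⟩
  | mul x y _ _ hx hy =>
    obtain ⟨z, hz, m, hm, rfl⟩ := hx
    obtain ⟨z', hz', m', hm', rfl⟩ := hy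
    refine ⟨z * z', Subgroup.mul_mem _ hz hz', z'⁻¹ * m * z'⁻¹⁻¹ * m',
      Subgroup.mul_mem _ (conj_mem_leviPrime (Subgroup.inv_mem _ hz') hm) hm', ?_⟩
    group
  | inv x _ hx =>
    obtain ⟨z, hz, m, hm, rfl⟩ := hx
    refine ⟨z⁻¹, Subgroup.inv_mem _ hz, z * m⁻¹ * z⁻¹,
      conj_mem_leviPrime hz (Subgroup.inv_mem _ hm), ?_⟩
    group

/-- The Kottwitz kernel contains the commutators of `Z(L)`, with `L` the maximal unramified
extension, and `Z(F) ⊆ Z(L)`. This is what makes `Λ` commutative. -/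
theorem commutator_mem_parahoric [ValuativeRel F] {a b : GL (Fin n) F} (ha : a ∈ zPts G S)
    (hb : b ∈ zPts G S) : a * b * a⁻¹ * b⁻¹ ∈ parahoric G S := by
  refine ⟨Subgroup.mul_mem _ (Subgroup.mul_mem _ (Subgroup.mul_mem _ ha hb)
    (Subgroup.inv_mem _ ha)) (Subgroup.inv_mem _ hb), ?_⟩
  refine Subgroup.subset_closure (Or.inl
    ⟨Matrix.GeneralLinearGroup.map (algebraMap F (unramified F)) a,
      Matrix.GeneralLinearGroup.map (algebraMap F (unramified F)) b, ha, hb, ?_⟩)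
  rw [← map_inv, ← map_inv, ← map_mul, ← map_mul, ← map_mul]
  ext i j
  rfl

/-! ### The subgroup `Λ ∩ W_{aff,P₂}` and its lift to `W(1)` -/

variable [ValuativeRel F] [TopologicalSpace F] [IsNonarchimedeanLocalField F]
  {D D₂ : Set (Fin S.rank → ℤ)}

/-- A representative in `M_{P₂}'` differs from one in `Z(F)` by an element of `Z⁰ ⊆ Z(F)`, so it
already lies in `Z(F)`. -/
theorem mem_latticeK_iff {w : LeviW G S D} : w ∈ latticeK G S D D₂ ↔
    ∃ y : nPts G S, y.1 ∈ zPts G S ∧ y.1 ∈ leviPrime G S D₂ ∧ QuotientGroup.mk y = w.val := by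
  constructor
  · rintro ⟨⟨x, hx, hxw⟩, ⟨y, hy, hyw⟩⟩
    refine ⟨y, ?_, hy, hyw⟩
    have h1 := QuotientGroup.eq.1 (hxw.trans hyw.symm)
    have h2 : x.1⁻¹ * y.1 ∈ zPts G S := h1.1
    have h3 := Subgroup.mul_mem _ (show x.1 ∈ zPts G S from hx) h2
    rwa [mul_inv_cancel_left] at h3
  · rintro ⟨y, hy, hy', h⟩
    exact ⟨⟨y, hy, h⟩, ⟨y, hy', h⟩⟩

theorem mem_latticeKOne_iff {w : LeviWOne G S D} : w ∈ latticeKOne G S D D₂ ↔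
    ∃ y : nPts G S, y.1 ∈ zPts G S ∧ y.1 ∈ leviPrime G S D₂ ∧ QuotientGroup.mk y = w.val := by
  constructor
  · rintro ⟨⟨x, hx, hxw⟩, ⟨y, hy, hyw⟩⟩
    refine ⟨y, ?_, hy, hyw⟩
    have h1 := QuotientGroup.eq.1 (hxw.trans hyw.symm)
    have h2 : x.1⁻¹ * y.1 ∈ zPts G S := (proRadical_le h1).1
    have h3 := Subgroup.mul_mem _ (show x.1 ∈ zPts G S from hx) h2
    rwa [mul_inv_cancel_left] at h3
  · rintro ⟨y, hy, hy', h⟩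
    exact ⟨⟨y, hy, h⟩, ⟨y, hy', h⟩⟩

/-- Write `x = z * m`: `m` commutes with `y`, and `z` normalizes both groups. -/
theorem conj_mem_zPts_inf_leviPrime
    (hcomm : ∀ g ∈ leviPrime G S D, ∀ h ∈ leviPrime G S D₂, Commute g h)
    {x y : GL (Fin n) F} (hx : x ∈ leviPts G S D) (hy : y ∈ zPts G S)
    (hy' : y ∈ leviPrime G S D₂) : x * y * x⁻¹ ∈ zPts G S ∧ x * y * x⁻¹ ∈ leviPrime G S D₂ := by
  obtain ⟨z, hz, m, hm, rfl⟩ := exists_mul_of_mem_leviPts hx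
  have h1 : z * m * y * (z * m)⁻¹ = z * y * z⁻¹ := by
    have h2 := (hcomm m hm y hy').eq
    calc _ = z * (m * y) * m⁻¹ * z⁻¹ := by group
      _ = _ := by rw [h2]; group
  rw [h1]
  exact ⟨Subgroup.mul_mem _ (Subgroup.mul_mem _ hz hy) (Subgroup.inv_mem _ hz),
    conj_mem_leviPrime hz hy'⟩

theorem latticeK_normal
    (hcomm : ∀ g ∈ leviPrime G S D, ∀ h ∈ leviPrime G S D₂, Commute g h) :
    (latticeK G S D D₂).Normal := by
  refine ⟨fun w hw v => ?_⟩
  rw [mem_latticeK_iff] at hw ⊢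
  obtain ⟨y, hy, hy', hyw⟩ := hw
  obtain ⟨_, x, hx, rfl⟩ := v
  have := conj_mem_zPts_inf_leviPrime hcomm hx hy hy'
  refine ⟨x * y * x⁻¹, this.1, this.2, ?_⟩
  rw [QuotientGroup.mk_mul, QuotientGroup.mk_mul, hyw]
  rfl

theorem latticeKOne_normal
    (hcomm : ∀ g ∈ leviPrime G S D, ∀ h ∈ leviPrime G S D₂, Commute g h) :
    (latticeKOne G S D D₂).Normal := by
  refine ⟨fun w hw v => ?_⟩
  rw [mem_latticeKOne_iff] at hw ⊢
  obtain ⟨y, hy, hy', hyw⟩ := hw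
  obtain ⟨_, x, hx, rfl⟩ := v
  have := conj_mem_zPts_inf_leviPrime hcomm hx hy hy'
  refine ⟨x * y * x⁻¹, this.1, this.2, ?_⟩
  rw [QuotientGroup.mk_mul, QuotientGroup.mk_mul, hyw]
  rfl

/-- `M_{P₂}'` commutes with `M_P'`, so these elements centralize `W_{aff,P}` and fix each simple
reflection. -/
theorem latticeK_le_leviOmega
    (hcomm : ∀ g ∈ leviPrime G S D, ∀ h ∈ leviPrime G S D₂, Commute g h)
    (Saff : Set (LeviAff G S D)) : latticeK G S D D₂ ≤ leviOmega G S Saff := by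
  intro w hw
  rw [mem_latticeK_iff] at hw
  obtain ⟨y, hy, hy', hyw⟩ := hw
  have key : ∀ a : LeviAff G S D, w * leviI G S D a * w⁻¹ = leviI G S D a := by
    rintro ⟨_, x, hx, rfl⟩
    rw [mul_inv_eq_iff_eq_mul]
    apply Subtype.ext
    have h1 : y * x = x * y := Subtype.ext (hcomm x.1 hx y.1 hy').eq.symm
    have h2 := congrArg (QuotientGroup.mk (s := (parahoric G S).subgroupOf (nPts G S))) h1
    rw [QuotientGroup.mk_mul, QuotientGroup.mk_mul, hyw] at h2
    exact h2
  unfold leviOmega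
  rw [Subgroup.mem_set_normalizer_iff]
  intro v
  constructor
  · rintro ⟨s, hs, rfl⟩
    exact ⟨s, hs, (key s).symm⟩
  · rintro ⟨s, hs, h⟩
    refine ⟨s, hs, ?_⟩
    rw [← key s] at h
    exact mul_left_cancel (mul_right_cancel h)

/-- The common representative in `Z(F) ∩ M_{P₂}'` defines the lift to `W(1)`. -/
theorem map_latticeKOne : (latticeKOne G S D D₂).map (leviProj G S D) = latticeK G S D D₂ := by
  apply le_antisymm
  · rintro _ ⟨w, hw, rfl⟩
    exact ⟨proj_mem_img G S hw.1, proj_mem_img G S hw.2⟩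
  · intro w hw
    obtain ⟨y, hy, hy', hyw⟩ := mem_latticeK_iff.1 hw
    refine ⟨⟨QuotientGroup.mk y, imgOne_mono G S (show zPts G S ≤ leviPts G S D from le_sup_left)
      ⟨y, hy, rfl⟩⟩, mem_latticeKOne_iff.2 ⟨y, hy, hy', rfl⟩, Subtype.ext hyw⟩

theorem kappaK_eq_comap :
    kappaK G S D₂ = (latticeKOne G S D D₂).comap (leviIota G S D) := by
  ext z
  exact ⟨fun hz => ⟨imgOne_mono G S inf_le_left z.2, hz⟩, fun hz => hz.2⟩

theorem exists_lattice_mul_leviI (w : LeviW G S D) :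
    ∃ l ∈ {l : LeviW G S D | l.val ∈ img G S (zPts G S)}, ∃ a, w = l * leviI G S D a := by
  obtain ⟨_, x, hx, rfl⟩ := w
  obtain ⟨z, hz, m, hm, hzm⟩ := exists_mul_of_mem_leviPts (show x.1 ∈ leviPts G S D from hx)
  have hzN : z ∈ nPts G S := zPts_le_nPts hz
  have hmN : m ∈ nPts G S := by
    have : m = z⁻¹ * x.1 := by rw [hzm]; group
    rw [this]
    exact Subgroup.mul_mem _ (Subgroup.inv_mem _ hzN) x.2
  have hzi : QuotientGroup.mk' _ ⟨z, hzN⟩ ∈ img G S (zPts G S) := ⟨⟨z, hzN⟩, hz, rfl⟩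
  refine ⟨⟨QuotientGroup.mk' _ ⟨z, hzN⟩, img_mono G S (show zPts G S ≤ leviPts G S D from
    le_sup_left) hzi⟩, hzi, ⟨QuotientGroup.mk' _ ⟨m, hmN⟩, ⟨m, hmN⟩, hm, rfl⟩, ?_⟩
  apply Subtype.ext
  have : x = ⟨z, hzN⟩ * ⟨m, hmN⟩ := Subtype.ext hzm
  exact congrArg (QuotientGroup.mk' _) this

theorem lattice_mul_comm {l l' : LeviW G S D} (hl : l.val ∈ img G S (zPts G S))
    (hl' : l'.val ∈ img G S (zPts G S)) : l * l' = l' * l := by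
  obtain ⟨x, hx, hxl⟩ := hl
  obtain ⟨y, hy, hyl⟩ := hl'
  apply Subtype.ext
  rw [Subgroup.coe_mul, Subgroup.coe_mul, ← hxl, ← hyl, ← map_mul, ← map_mul]
  refine QuotientGroup.eq.2 ?_
  have := commutator_mem_parahoric (G := G) (S := S) (Subgroup.inv_mem _ hy) (Subgroup.inv_mem _ hx)
  have h1 : (x * y)⁻¹ * (y * x) = y⁻¹ * x⁻¹ * y⁻¹⁻¹ * x⁻¹⁻¹ := by group
  rw [h1]
  exact this

end AlgGrp

end

theorem mainTheorem8 {F : Type*} [Field F] [ValuativeRel F] [TopologicalSpace F]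
    [IsNonarchimedeanLocalField F] {n : ℕ}
    (G : Subgroup (GL (Fin n) (AlgebraicClosure F))) (hG : AlgGrp.IsConnectedReductive F G)
    (S : AlgGrp.SplitTorus F n) (hS : S.IsMaximalIn G)
    {ι : Type*} [Finite ι] (R : RootPairing ι ℝ (Fin S.rank → ℝ) (Fin S.rank → ℝ))
    [R.IsCrystallographic] (hR : AlgGrp.IsRelativeRootSystem G S R)
    (Δ : Set (Fin S.rank → ℤ)) (hΔ : AlgGrp.IsSimpleRoots G S Δ)
    (D : Set (Fin S.rank → ℤ)) (hD : D ⊆ Δ)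
    (orth : ∀ α ∈ D, ∀ β ∈ Δ \ D, ∀ a b : ι, (R.root a = fun k => (α k : ℝ)) →
      (R.root b = fun k => (β k : ℝ)) → R.pairing a b = 0)
    {C : Type*} [CommRing C]
    (Saff : Set (AlgGrp.LeviAff G S D))
    (hdatum : ProP.IsDatum Saff (AlgGrp.leviI G S D) (AlgGrp.leviOmega G S Saff).subtype
      (AlgGrp.leviIota G S D) (AlgGrp.leviProj G S D))
    (q : Saff → C)
    (c : ProP.reflOne Saff (AlgGrp.leviI G S D) (AlgGrp.leviProj G S D) →
      MonoidAlgebra C (AlgGrp.ZKappa G S))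
    (hparam : ProP.IsParameter Saff (AlgGrp.leviI G S D) (AlgGrp.leviIota G S D)
      (AlgGrp.leviProj G S D) q c)
    {H : Type*} [Ring H] [Algebra C H] (T : Module.Basis (AlgGrp.LeviWOne G S D) C H)
    (hT : ProP.IsHeckeAlgebra Saff (AlgGrp.leviI G S D) (AlgGrp.leviOmega G S Saff).subtype
      (AlgGrp.leviIota G S D) (AlgGrp.leviProj G S D) q c T) :
    ∃ (_ : (AlgGrp.latticeK G S D (Δ \ D)).Normal)
      (_ : (AlgGrp.latticeKOne G S D (Δ \ D)).Normal)
      (_ : (AlgGrp.kappaK G S (Δ \ D)).Normal),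
      AlgGrp.latticeK G S D (Δ \ D) ≤ AlgGrp.leviOmega G S Saff ∧
      ProP.IsDatum Saff (AlgGrp.quotI G S D (Δ \ D)) (AlgGrp.quotJ G S (Δ \ D) Saff)
        (AlgGrp.quotIota G S D (Δ \ D)) (AlgGrp.quotProj G S D (Δ \ D)) ∧
      (∃ c' : ProP.reflOne Saff (AlgGrp.quotI G S D (Δ \ D)) (AlgGrp.quotProj G S D (Δ \ D)) →
          MonoidAlgebra C (AlgGrp.ZKappa G S ⧸ AlgGrp.kappaK G S (Δ \ D)),
        (∀ (s : ProP.reflOne Saff (AlgGrp.leviI G S D) (AlgGrp.leviProj G S D))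
            (s' : ProP.reflOne Saff (AlgGrp.quotI G S D (Δ \ D)) (AlgGrp.quotProj G S D (Δ \ D))),
          s'.val = QuotientGroup.mk s.val →
          c' s' = MonoidAlgebra.mapDomain QuotientGroup.mk (c s)) ∧
        ProP.IsParameter Saff (AlgGrp.quotI G S D (Δ \ D)) (AlgGrp.quotIota G S D (Δ \ D))
          (AlgGrp.quotProj G S D (Δ \ D)) q c' ∧
        ∃ T' : Module.Basis (AlgGrp.LeviWOne G S D ⧸ AlgGrp.latticeKOne G S D (Δ \ D)) C
            (AlgGrp.heckeIdeal G S (Δ \ D) T).ringCon.Quotient,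
          (∀ w : AlgGrp.LeviWOne G S D, T' (QuotientGroup.mk w) =
            (AlgGrp.heckeIdeal G S (Δ \ D) T).ringCon.mk' (T w)) ∧
          ProP.IsHeckeAlgebra Saff (AlgGrp.quotI G S D (Δ \ D))
            (AlgGrp.quotJ G S (Δ \ D) Saff) (AlgGrp.quotIota G S D (Δ \ D))
            (AlgGrp.quotProj G S D (Δ \ D)) q c' T') ∧
      ∀ u v : AlgGrp.leviOmega G S Saff ⧸
        (AlgGrp.latticeK G S D (Δ \ D)).subgroupOf (AlgGrp.leviOmega G S Saff),
        u * v = v * u := by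
  have hcomm : ∀ g ∈ AlgGrp.leviPrime G S D, ∀ h ∈ AlgGrp.leviPrime G S (Δ \ D), Commute g h :=
    fun g hg h hh => AlgGrp.commute_of_mem_leviPrime hS.1 hR hΔ hD orth hg hh
  have hN : (AlgGrp.latticeK G S D (Δ \ D)).Normal := AlgGrp.latticeK_normal hcomm
  have hN₁ : (AlgGrp.latticeKOne G S D (Δ \ D)).Normal := AlgGrp.latticeKOne_normal hcomm
  have hNz : (AlgGrp.kappaK G S (Δ \ D)).Normal :=
    ⟨fun x hx z => by rwa [hdatum.comm z x, mul_inv_cancel_right]⟩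
  have hle := AlgGrp.latticeK_le_leviOmega hcomm Saff
  have hK : AlgGrp.latticeK G S D (Δ \ D) ≤ (AlgGrp.leviOmega G S Saff).subtype.range := by
    rwa [Subgroup.range_subtype]
  have hmap := AlgGrp.map_latticeKOne (G := G) (S := S) (D := D) (D₂ := Δ \ D)
  have hι := AlgGrp.kappaK_eq_comap (G := G) (S := S) (D := D) (D₂ := Δ \ D)
  have hπ := Subgroup.map_le_iff_le_comap.1 hmap.le
  refine ⟨hN, hN₁, hNz, hle, hdatum.quotient _ _ _ hK hmap hι hπ hι.le, ?_, ?_⟩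
  · obtain ⟨c', hc', hparam'⟩ := hparam.exists_quotient hdatum hK hmap hπ hι hι.le
    obtain ⟨T', hT'⟩ := hT.exists_basis_quotient hK hπ
    exact ⟨c', hc', hparam', T', hT', hT.quotient hdatum hK hmap hπ hι.le hc' hT'⟩
  · intro u v
    induction u using QuotientGroup.induction_on with | _ u
    induction v using QuotientGroup.induction_on with | _ v
    -- `Ω_P` is commutative already before the quotient is taken.
    exact congrArg _ (hdatum.commute_of_supplement AlgGrp.exists_lattice_mul_leviI
      (fun l hl l' hl' => AlgGrp.lattice_mul_comm hl hl') u v)
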